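/- Let $A$ be a finite alphabet. For a map $T:A^{\mathbb Z}\to A^{\mathbb Z}$ and $\Gamma\subset A^{\mathbb Z}$ the trace of $T$ on $\Gamma$ is $\{(T^j(x)_0)_{j\in\mathbb N} : x\in\Gamma\}\subset A^{\mathbb N}$. A cellular automaton (CA) of anchor $m\in\mathbb Z$, diameter $d>0$ and local rule $f:A^d\to A$ is the map $F(x)_i=f(x_{i-m},\dots,x_{i-m+d-1})$. A set $\Sigma\subset A^{\mathbb N}$ is a sofic subshift if it is the set of labels of infinite paths of a finite edge-labelled graph (a graph of $\Sigma$); likewise a graph of a two-sided subshift presents it by the labels of its bi-infinite paths. A subshift of finite type (SFT) $\Gamma\subset A^{\mathbb Z}$ is the set of configurations avoiding a finite set of words. A CA $G$ of anchor $0$ and diameter $2$ on an alphabet $B\subset A^k$ polytraces $\Sigma$ if $\Sigma=\bigcup_{0\le q<k}\pi_q(\tau_G)$, where $\tau_G\subset B^{\mathbb N}$ is the trace of $G$ on $B^{\mathbb Z}$ and $\pi_q$ takes the $q$-th component of every letter; $\Sigma$ is polytraceable if such a $G$ exists. $\Sigma$ is partially traceable if there are a CA $F$ on $A$ and an SFT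 $\Gamma\subset A^{\mathbb Z}$ with $F(\Gamma)\subset\Gamma$ such that the trace of $F$ on $\Gamma$ is $\Sigma$. Every polytraceable sofic subshift $\Sigma$ is partially traceable, and effectively so: there is one algorithm which, given a finite alphabet $A=\{0,\dots,n-1\}$, a graph of a sofic subshift $\Sigma\subset A^{\mathbb N}$ and a CA polytracing $\Sigma$ (by its alphabet and the table of its local rule), computes such a CA $F$ (its anchor, diameter and local rule) and a graph of such an SFT $\Gamma$. -/

import Mathlib

namespace PartialTrace

/-- The global function `A^ℤ → A^ℤ` of the cellular automaton with anchor `m`, diameter `d` and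
local rule `f : A^d → A`: the new state of cell `i` is `f (x_{i-m}, …, x_{i-m+d-1})`. -/
def globalMap {A : Type*} (m : ℤ) {d : ℕ} (f : (Fin d → A) → A) (x : ℤ → A) : ℤ → A :=
  fun i => f fun j => x (i - m + (j : ℕ))

/-- The trace of a self-map `T` of `A^ℤ` on a set `Γ` of configurations:
all the sequences `(T^j(x)_0)_j` with `x ∈ Γ`. -/
def trace {A : Type*} (T : (ℤ → A) → ℤ → A) (Γ : Set (ℤ → A)) : Set (ℕ → A) :=
  (fun x j => T^[j] x 0) '' Γ

/-- The polytrace of the cellular automaton of anchor `0`, diameter `2` and local rule `g` over the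
alphabet `B ⊆ A^k`: the union over `q < k` of the `q`-th projections of its trace. -/
def polytrace {A : Type*} {k : ℕ} {B : Set (Fin k → A)} (g : (Fin 2 → B) → B) : Set (ℕ → A) :=
  ⋃ q : Fin k, (fun (z : ℕ → B) j => (z j : Fin k → A) q) '' trace (globalMap 0 g) Set.univ

/-- `S` is the polytrace of a cellular automaton of anchor `0` and diameter `2` over some
alphabet `B ⊆ A^k`. -/
def IsPolytraceable {A : Type*} (S : Set (ℕ → A)) : Prop :=
  ∃ (k : ℕ) (B : Set (Fin k → A)) (g : (Fin 2 → B) → B), polytrace g = S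

/-- Labels of the infinite paths of a finite edge-labelled graph; the graph is the finite set of
its edges (source, label, target), the vertices being named by natural numbers. -/
def rightLabels {A : Type*} (E : Finset (ℕ × A × ℕ)) : Set (ℕ → A) :=
  {z | ∃ v : ℕ → ℕ, ∀ i, (v i, z i, v (i + 1)) ∈ E}

/-- Labels of the bi-infinite paths of a finite edge-labelled graph. -/
def biLabels {A : Type*} (E : Finset (ℕ × A × ℕ)) : Set (ℤ → A) :=
  {x | ∃ v : ℤ → ℕ, ∀ i, (v i, x i, v (i + 1)) ∈ E}

/-- One-sided sofic subshifts. (Closedness and shift-invariance are automatic.) -/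
def IsSofic {A : Type*} (S : Set (ℕ → A)) : Prop :=
  ∃ E : Finset (ℕ × A × ℕ), rightLabels E = S

/-- The word `w` is a factor of the configuration `x`. -/
def Occurs {A : Type*} (w : List A) (x : ℤ → A) : Prop :=
  ∃ i : ℤ, ∀ j : Fin w.length, x (i + (j : ℕ)) = w.get j

/-- Two-sided subshifts of finite type: a finite set of forbidden words. -/
def IsSFT {A : Type*} (Γ : Set (ℤ → A)) : Prop :=
  ∃ W : Finset (List A), Γ = {x | ∀ w ∈ W, ¬ Occurs w x}

/-- The cellular automaton with anchor `m`, diameter `d` and local rule `f`, restricted to `Γ`,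
is a partial cellular automaton `Γ → Γ` on a subshift of finite type, and its trace is `S`. -/
def PartiallyTraces {A : Type*} (m : ℤ) {d : ℕ} (f : (Fin d → A) → A) (Γ : Set (ℤ → A))
    (S : Set (ℕ → A)) : Prop :=
  0 < d ∧ IsSFT Γ ∧ Set.MapsTo (globalMap m f) Γ Γ ∧ trace (globalMap m f) Γ = S

def IsPartiallyTraceable {A : Type*} (S : Set (ℕ → A)) : Prop :=
  ∃ (m : ℤ) (d : ℕ) (f : (Fin d → A) → A) (Γ : Set (ℤ → A)), PartiallyTraces m f Γ S

/-! Finite representations over the alphabet `{0, …, n-1}`, as inputs and outputs of algorithms. -/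

/-- A word over `Fin n` as a list of natural numbers. -/
def wordCode {n k : ℕ} (w : Fin k → Fin n) : List ℕ :=
  List.ofFn fun i => (w i : ℕ)

/-- Representations of cellular automata of anchor `0` and diameter `2` over an alphabet of
`k`-letter words: `k`, the list of the letters, and the table of the local rule. -/
abbrev PolyCode : Type := ℕ × List (List ℕ) × List ((List ℕ × List ℕ) × List ℕ)

/-- Representations of cellular automata: anchor, diameter, and the table of the local rule. -/
abbrev CACode : Type := ℤ × ℕ × List (List ℕ × ℕ)

/-- Representations of edge-labelled graphs: the list of the edges (source, label, target). -/
abbrev GraphCode : Type := List (ℕ × ℕ × ℕ)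

def PolyCode.Represents (c : PolyCode) {n k : ℕ} {B : Set (Fin k → Fin n)}
    (g : (Fin 2 → B) → B) : Prop :=
  c.1 = k ∧
  (∀ w, w ∈ c.2.1 ↔ ∃ b : B, w = wordCode (b : Fin k → Fin n)) ∧
  ∀ e, e ∈ c.2.2 ↔ ∃ b : Fin 2 → B,
    e = ((wordCode (b 0 : Fin k → Fin n), wordCode (b 1 : Fin k → Fin n)),
      wordCode (g b : Fin k → Fin n))

def CACode.Represents (c : CACode) {n : ℕ} (m : ℤ) {d : ℕ} (f : (Fin d → Fin n) → Fin n) : Prop :=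
  c.1 = m ∧ c.2.1 = d ∧ ∀ e, e ∈ c.2.2 ↔ ∃ w : Fin d → Fin n, e = (wordCode w, (f w : ℕ))

def GraphCode.Represents (c : GraphCode) {n : ℕ} (E : Finset (ℕ × Fin n × ℕ)) : Prop :=
  ∀ e, e ∈ c ↔ ∃ (p : ℕ) (a : Fin n) (q : ℕ), (p, a, q) ∈ E ∧ e = (p, (a : ℕ), q)

end PartialTrace

open PartialTrace

namespace PartialTrace

/-! ### Marked blocks

A block consists of a marker, which spells a row of letters in a self-synchronizing way, and of a
word of data. -/

/-! A state of the polytracing automaton `g` is a word of `k` letters, so an automaton on `A` can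
simulate `g` on blocks of cells, each data cell displaying one component of an orbit of `g`. To
locate the boundaries, every block also carries a marker. Marker cells are traced too, so what they
display must lie in Σ: at time `t` the marker spells the row `(s c t)_c` of a finite family `s` of
sequences of Σ that is closed under the shift, whence each row determines the next (`row_succ_eq`).
A marker with a nonconstant row is self-synchronizing (`blocks_recognizable`). So a window of four
block lengths determines the new letter (`IsStep.unique`), the configurations with only legal
windows are the concatenations of blocks with a common row (`exists_config_of_isStep`), and the
trace on this SFT is `Set.range s ∪ polytrace g` (`partiallyTraces_of_isStep`).

A suitable `s` comes from a dichotomy on the graph (`hasDistinctCycles_or_nilpotent`). If two closed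
paths of equal length start with different labels, all shifts of their two periodic labels,
interleaved, form a family whose rows are never constant. Otherwise all closed paths carry one
letter `a`, so a sequence of Σ has boundedly many letters other than `a`. A one-sided automaton with
boundedly many active times in each cell is nilpotent (`rightMap_nilpotent`), so all sequences of Σ
equal `a` from a common time on and Σ is finite. Then `s` enumerates Σ and no data is needed (`k =
0`).

Each branch has finite, decidable certificates, and either kind yields a correct output. The
algorithm searches for any certificate; the dichotomy makes the search terminate. -/

def markerIndex (k r p : ℕ) : ℕ :=
  if p % (r + 1) < p / (r + 1) - (r + k + 2) then p / (r + 1) - (r + k + 2) else 0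

def markerLength (k r : ℕ) : ℕ := (2 * (r + 1) + k + 1) * (r + 1)

def blockLength (k r : ℕ) : ℕ := markerLength k r + k

/-- The marker is cut into segments of `r + 1` cells. The first `r + k + 2` segments contain only `ρ
0`; segment `r + k + 2 + s` consists of `s` letters `ρ s` followed by letters `ρ 0`. The last branch
is a junk value beyond the end of the block. -/
def block {A : Type*} {k r : ℕ} (ρ : Fin (r + 1) → A) (d : Fin k → A) (p : ℕ) : A :=
  if p < markerLength k r then ρ (Fin.ofNat (r + 1) (markerIndex k r p))
  else if h : p - markerLength k r < k then d ⟨p - markerLength k r, h⟩ else ρ 0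

lemma markerLength_pos (k r : ℕ) : 0 < markerLength k r := by
  unfold markerLength; positivity

lemma blockLength_pos (k r : ℕ) : 0 < blockLength k r :=
  Nat.add_pos_left (markerLength_pos k r) k

lemma markerLength_le (k r : ℕ) : markerLength k r ≤ blockLength k r := Nat.le_add_right _ _

lemma markerIndex_lt {k r p : ℕ} (hp : p < markerLength k r) : markerIndex k r p < r + 1 := by
  unfold markerIndex markerLength at *
  have : p / (r + 1) < 2 * (r + 1) + k + 1 := Nat.div_lt_of_lt_mul (by rwa [mul_comm])
  split_ifs <;> omega

lemma markerIndex_seg (k r s c : ℕ) (hc : c < r + 1) :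
    markerIndex k r ((r + k + 2 + s) * (r + 1) + c) = if c < s then s else 0 := by
  have h1 : ((r + k + 2 + s) * (r + 1) + c) % (r + 1) = c := by
    rw [Nat.mul_add_mod_self_right, Nat.mod_eq_of_lt hc]
  have h2 : ((r + k + 2 + s) * (r + 1) + c) / (r + 1) = r + k + 2 + s := by
    rw [mul_comm, Nat.mul_add_div (Nat.succ_pos r), Nat.div_eq_of_lt hc, add_zero]
  simp [markerIndex, h1, h2]

lemma markerIndex_init {k r p : ℕ} (hp : p < (r + k + 2) * (r + 1)) : markerIndex k r p = 0 := by
  have : p / (r + 1) < r + k + 2 := Nat.div_lt_of_lt_mul (by rwa [mul_comm])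
  unfold markerIndex
  split_ifs <;> omega

lemma seg_lt {k r s c : ℕ} (hs : s < r + 1) (hc : c < r + 1) :
    (r + k + 2 + s) * (r + 1) + c < markerLength k r := by
  unfold markerLength
  have : (r + k + 2 + s + 1) * (r + 1) ≤ (2 * (r + 1) + k + 1) * (r + 1) :=
    Nat.mul_le_mul_right _ (by omega)
  nlinarith

/-- This is the reason for the `r + k + 2` constant segments: initial runs longer than half a block
must overlap in any two superposed concatenations. -/
lemma blockLength_lt (k r : ℕ) : blockLength k r < 2 * ((r + k + 2) * (r + 1)) := by
  unfold blockLength markerLength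
  nlinarith [Nat.zero_le (k * r)]

section block
variable {A : Type*} {k r : ℕ} (ρ : Fin (r + 1) → A) (d : Fin k → A)

lemma block_seg {s c : ℕ} (hs : s < r + 1) (hc : c < r + 1) :
    block ρ d ((r + k + 2 + s) * (r + 1) + c) = if c < s then ρ ⟨s, hs⟩ else ρ 0 := by
  rw [block, if_pos (seg_lt hs hc), markerIndex_seg k r s c hc]
  split_ifs
  · congr 1; ext; simp [Nat.mod_eq_of_lt hs]
  · rfl

lemma block_init {p : ℕ} (hp : p < (r + k + 2) * (r + 1)) : block ρ d p = ρ 0 := by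
  have : p < markerLength k r := by
    have := seg_lt (k := k) (Nat.succ_pos r) (Nat.succ_pos r)
    simp only [add_zero] at this
    omega
  rw [block, if_pos this, markerIndex_init hp]
  rfl

lemma block_data (i : Fin k) : block ρ d (markerLength k r + i) = d i := by
  rw [block, if_neg (by omega), dif_pos (by simp)]
  congr 1; ext; simp

lemma block_marker {p : ℕ} (hp : p < markerLength k r) :
    block ρ d p = ρ ⟨markerIndex k r p, markerIndex_lt hp⟩ := by
  rw [block, if_pos hp]
  congr 1; ext; simp [Nat.mod_eq_of_lt (markerIndex_lt hp)]

lemma block_const {a : A} (hρ : ∀ i, ρ i = a) (hk : k = 0) (p : ℕ) : block ρ d p = a := by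
  subst hk
  rw [block]
  split_ifs with h h'
  · exact hρ _
  · exact absurd h' (by simp)
  · exact hρ _

/-- Infinite concatenations of blocks with a common marker. -/
def blocks (b : ℕ → Fin k → A) (y : ℕ) : A :=
  block ρ (b (y / blockLength k r)) (y % blockLength k r)

lemma blocks_add (b : ℕ → Fin k → A) (j : ℕ) {p : ℕ} (hp : p < blockLength k r) :
    blocks ρ b (j * blockLength k r + p) = block ρ (b j) p := by
  have h1 : (j * blockLength k r + p) / blockLength k r = j := by
    rw [mul_comm, Nat.mul_add_div (blockLength_pos k r), Nat.div_eq_of_lt hp, add_zero]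
  rw [blocks, h1, Nat.mul_add_mod_self_right, Nat.mod_eq_of_lt hp]

end block

/-- From position `u` on, `Z` reads a run of at least `e` letters `a`, then exactly `s` letters `b`
followed by `a`. -/
structure HasRun {A : Type*} (Z : ℕ → A) (a b : A) (e s u : ℕ) : Prop where
  ne : a ≠ b
  pos : 0 < s
  init : ∀ p < e, Z (u + p) = a
  mid : ∀ c < s, Z (u + e + c) = b
  fin : Z (u + e + s) = a

/-- The cells before `u` may also contain `a`, so only the end of a run is visible. Overlapping runs
have the same letter, hence the same end, hence the same number of letters `b` after it. As the
length of the run is a function `E` of that number, the starts agree as well. -/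
lemma HasRun.eq_of_overlap {A : Type*} {Z : ℕ → A} {a b a' b' : A} {E : ℕ → ℕ} {s s' u u' : ℕ}
    (h : HasRun Z a b (E s) s u) (h' : HasRun Z a' b' (E s') s' u') (h1 : u ≤ u')
    (h2 : u' < u + E s) (h3 : 0 < E s') : u = u' := by
  have haa : a = a' := by
    rw [← h'.init 0 h3, ← h.init (u' - u) (by omega)]; congr 1; omega
  subst haa
  have he : u + E s = u' + E s' := by
    rcases lt_trichotomy (u + E s) (u' + E s') with hlt | heq | hlt
    · have e1 := h.mid 0 h.pos
      have e2 := h'.init (u + E s - u') (by omega)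
      rw [show u' + (u + E s - u') = u + E s + 0 by omega] at e2
      exact absurd (e2.symm.trans e1) h.ne
    · exact heq
    · have e1 := h'.mid 0 h'.pos
      have e2 := h.init (u' + E s' - u) (by omega)
      rw [show u + (u' + E s' - u) = u' + E s' + 0 by omega] at e2
      exact absurd (e2.symm.trans e1) h'.ne
  have hb : b = b' := by
    have e1 := h.mid 0 h.pos
    rw [he, h'.mid 0 h'.pos] at e1
    exact e1.symm
  subst hb
  have hs : s = s' := by
    rcases lt_trichotomy s s' with hlt | heq | hlt
    · have e1 := h.fin
      rw [he, h'.mid s hlt] at e1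
      exact absurd e1.symm h.ne
    · exact heq
    · have e1 := h'.fin
      rw [← he, h.mid s' hlt] at e1
      exact absurd e1.symm h.ne
  subst hs
  omega

/-! ### Self-synchronization of the markers. -/

section recognition
variable {A : Type*} {k r : ℕ}

/-- Take the least `s` with `ρ s ≠ ρ 0`. The earlier segments are constant and lengthen the initial
run up to segment `s`, which spells `s > 0` letters `ρ s` and then, since `s ≤ r`, a letter `ρ 0`.
Neither `b` nor `s` depends on the data or on the position. -/
lemma exists_hasRun {ρ : Fin (r + 1) → A} (hρ : ∃ i, ρ i ≠ ρ 0) :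
    ∃ b s, s < r + 1 ∧ ∀ (d : ℕ → Fin k → A) (Z : ℕ → A) (j u : ℕ),
      (∀ p < blockLength k r, Z (u + p) = blocks ρ d (j * blockLength k r + p)) →
      HasRun Z (ρ 0) b ((r + k + 2 + s) * (r + 1)) s u := by
  classical
  have hex : ∃ s : ℕ, ∃ h : s < r + 1, ρ ⟨s, h⟩ ≠ ρ 0 := by
    obtain ⟨i, hi⟩ := hρ; exact ⟨i, i.2, hi⟩
  obtain ⟨hs, hne⟩ := Nat.find_spec hex
  have hmin : ∀ s' < Nat.find hex, ∀ h : s' < r + 1, ρ ⟨s', h⟩ = ρ 0 := fun s' h' h => by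
    by_contra hc; exact Nat.find_min hex h' ⟨h, hc⟩
  generalize Nat.find hex = s at *
  have hpos : 0 < s := by
    rcases Nat.eq_zero_or_pos s with h | h
    · subst h; exact absurd rfl hne
    · exact h
  refine ⟨ρ ⟨s, hs⟩, s, hs, fun d Z j u hZ => ?_⟩
  have key : ∀ s' c, s' < r + 1 → c < r + 1 → Z (u + ((r + k + 2 + s') * (r + 1) + c)) =
      if h : c < s' ∧ s' < r + 1 then ρ ⟨s', h.2⟩ else ρ 0 := fun s' c h1 h2 => by
    have h3 := (seg_lt (k := k) h1 h2).trans_le (markerLength_le k r)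
    rw [hZ _ h3, blocks_add _ _ _ h3, block_seg _ _ h1 h2]
    split_ifs <;> tauto
  refine ⟨hne.symm, hpos, fun p hp => ?_, fun c hc => ?_, ?_⟩
  · by_cases hp' : p < (r + k + 2) * (r + 1)
    · have h3 := seg_lt (k := k) (Nat.succ_pos r) (Nat.succ_pos r)
      have h4 := markerLength_le k r
      simp only [add_zero] at h3
      rw [hZ p (by omega), blocks_add _ _ _ (by omega), block_init _ _ hp']
    · have h5 : p / (r + 1) < r + k + 2 + s := Nat.div_lt_of_lt_mul (by rwa [mul_comm])
      have h6 : r + k + 2 ≤ p / (r + 1) := (Nat.le_div_iff_mul_le (Nat.succ_pos r)).2 (not_lt.1 hp')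
      have h7 := key (p / (r + 1) - (r + k + 2)) (p % (r + 1)) (by omega)
        (Nat.mod_lt _ (Nat.succ_pos r))
      rw [show r + k + 2 + (p / (r + 1) - (r + k + 2)) = p / (r + 1) by omega,
        Nat.div_add_mod'] at h7
      rw [h7]
      split_ifs with h
      · exact hmin _ (by omega) _
      · rfl
  · rw [add_assoc, key s c hs (by omega), dif_pos ⟨hc, hs⟩]
  · rw [add_assoc, key s s hs hs, dif_neg (by omega)]

/-- Three block lengths contain two complete blocks of each decomposition, enough for two initial
runs to overlap; once the phases agree the row is read off the marker. The bounds on the phases are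
not strict because a phase `q + 1` occurs when windows are moved by one cell. A constant row is
tolerated only without data, where a block is constant and has no phase. -/
theorem blocks_recognizable {ρ ρ' : Fin (r + 1) → A} {d d' : ℕ → Fin k → A} {q q' : ℕ}
    (hρ : (∃ i, ρ i ≠ ρ 0) ∨ k = 0) (hρ' : (∃ i, ρ' i ≠ ρ' 0) ∨ k = 0)
    (hq : q ≤ blockLength k r) (hq' : q' ≤ blockLength k r)
    (h : ∀ p < 3 * blockLength k r, blocks ρ d (p + q) = blocks ρ' d' (p + q')) :
    ρ = ρ' ∧ (q ≡ q' [MOD blockLength k r] ∨ k = 0 ∧ ∀ i, ρ i = ρ 0) := by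
  have hP := blockLength_pos k r
  have hL := blockLength_lt k r
  by_cases c : ∃ i, ρ i ≠ ρ 0
  · by_cases c' : ∃ i, ρ' i ≠ ρ' 0
    · obtain ⟨b, s, hs, H⟩ := exists_hasRun (k := k) c
      obtain ⟨b', s', hs', H'⟩ := exists_hasRun (k := k) c'
      set P := blockLength k r with hPdef
      have Hr : ∀ j < 2, HasRun (fun p => blocks ρ d (p + q)) (ρ 0) b
          ((r + k + 2 + s) * (r + 1)) s (P - q + j * P) := fun j _ =>
        H d _ (j + 1) _ fun p _ => by congr 1; rw [add_mul]; omega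
      have Hr' : ∀ j < 2, HasRun (fun p => blocks ρ d (p + q)) (ρ' 0) b'
          ((r + k + 2 + s') * (r + 1)) s' (P - q' + j * P) := fun j hj =>
        H' d' _ (j + 1) _ fun p hp => by
          have : j * P ≤ 1 * P := Nat.mul_le_mul_right _ (by omega)
          rw [h _ (by omega)]
          congr 1; rw [add_mul]; omega
      have hE : (r + k + 2) * (r + 1) ≤ (r + k + 2 + s) * (r + 1) :=
        Nat.mul_le_mul_right _ (by omega)
      have hE' : (r + k + 2) * (r + 1) ≤ (r + k + 2 + s') * (r + 1) :=
        Nat.mul_le_mul_right _ (by omega)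
      have hpos : 0 < (r + k + 2) * (r + 1) := by positivity
      -- If the first runs do not overlap, their starts are more than half a block apart, so the
      -- second run of the earlier decomposition starts inside the first run of the other.
      have key : q = q' ∨ q = q' + P ∨ q' = q + P := by
        have a0 := Hr 0 (by omega)
        have a1 := Hr 1 (by omega)
        have a0' := Hr' 0 (by omega)
        have a1' := Hr' 1 (by omega)
        let E : ℕ → ℕ := fun s => (r + k + 2 + s) * (r + 1)
        rcases le_total (P - q) (P - q') with hle | hle
        · by_cases hlt : P - q' < P - q + (r + k + 2 + s) * (r + 1)
          · have := a0.eq_of_overlap (E := E) a0' (by omega) (by simpa [E] using hlt)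
              (hpos.trans_le hE')
            omega
          · have := a0'.eq_of_overlap (E := E) a1 (by omega) (by simp only [E]; omega)
              (hpos.trans_le hE)
            omega
        · by_cases hlt : P - q < P - q' + (r + k + 2 + s') * (r + 1)
          · have := a0'.eq_of_overlap (E := E) a0 (by omega) (by simpa [E] using hlt)
              (hpos.trans_le hE)
            omega
          · have := a0.eq_of_overlap (E := E) a1' (by omega) (by simp only [E]; omega)
              (hpos.trans_le hE')
            omega
      have hmod : q ≡ q' [MOD P] := by
        rcases key with h1 | h1 | h1 <;> rw [h1] <;> simp [Nat.ModEq]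
      refine ⟨?_, Or.inl hmod⟩
      have rd : ∀ p < markerLength k r, ρ (Fin.ofNat _ (markerIndex k r p)) =
          ρ' (Fin.ofNat _ (markerIndex k r p)) := fun p hp => by
        have hp' : p < P := hp.trans_le (markerLength_le k r)
        have e : ∃ j j', blocks ρ d (j * P + p) = blocks ρ' d' (j' * P + p) := by
          rcases key with h1 | h1 | h1
          · refine ⟨1, 1, ?_⟩
            have := h (P - q + p) (by omega)
            convert this using 2 <;> omega
          · refine ⟨2, 1, ?_⟩
            have := h (P - q' + p) (by omega)
            convert this using 2 <;> omega
          · refine ⟨1, 2, ?_⟩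
            have := h (P - q + p) (by omega)
            convert this using 2 <;> omega
        obtain ⟨j, j', e⟩ := e
        rw [blocks_add _ _ _ hp', blocks_add _ _ _ hp', block, block, if_pos hp, if_pos hp] at e
        exact e
      funext i
      by_cases hi : (i : ℕ) = 0
      · have := rd 0 (markerLength_pos k r)
        rw [markerIndex_init hpos] at this
        convert this using 2 <;> (ext; simp [hi])
      · have := rd _ (seg_lt (c := 0) i.2 (Nat.succ_pos r))
        rw [markerIndex_seg k r i 0 (Nat.succ_pos r), if_pos (by omega)] at this
        convert this using 2 <;> (ext; simp)
    · have hk := hρ'.resolve_left c'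
      push Not at c'
      exfalso
      obtain ⟨b, s, hs, H⟩ := exists_hasRun (k := k) c
      have a0 := H d (fun p => blocks ρ d (p + q)) 1 (blockLength k r - q)
        fun p _ => by congr 1; omega
      have hlt := seg_lt (k := k) hs (Nat.succ_pos r)
      have hle := markerLength_le k r
      have e1 := a0.init 0 (by positivity)
      have e2 := a0.mid 0 a0.pos
      rw [h _ (by omega)] at e1 e2
      rw [blocks, block_const _ _ c' hk] at e1 e2
      exact a0.ne (e1.symm.trans e2)
  · have hk := hρ.resolve_left c
    push Not at c
    have e0 : ∀ p < 3 * blockLength k r, ρ 0 = blocks ρ' d' (p + q') := fun p hp => by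
      rw [← h p hp, blocks, block_const _ _ c hk]
    by_cases c' : ∃ i, ρ' i ≠ ρ' 0
    · exfalso
      obtain ⟨b, s, hs, H⟩ := exists_hasRun (k := k) c'
      have a0 := H d' (fun p => blocks ρ' d' (p + q')) 1 (blockLength k r - q')
        fun p _ => by congr 1; omega
      have hlt := seg_lt (k := k) hs (Nat.succ_pos r)
      have hle := markerLength_le k r
      have e1 := a0.init 0 (by positivity)
      have e2 := a0.mid 0 a0.pos
      rw [← e0 _ (by omega)] at e1 e2
      exact a0.ne (e1.symm.trans e2)
    · push Not at c'
      have e1 := e0 0 (by omega)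
      rw [blocks, block_const _ _ c' hk] at e1
      exact ⟨funext fun i => by rw [c, c', e1], Or.inr ⟨hk, c⟩⟩

end recognition

lemma isSFT_of_windows {A : Type*} [Finite A] {n : ℕ} (Q : (Fin n → A) → Prop) :
    IsSFT {x : ℤ → A | ∀ i : ℤ, Q fun j => x (i + (j : ℕ))} := by
  classical
  have hfin : {w : Fin n → A | ¬ Q w}.Finite := Set.toFinite _
  refine ⟨hfin.toFinset.image List.ofFn, ?_⟩
  have occ : ∀ (w : Fin n → A) (x : ℤ → A),
      Occurs (List.ofFn w) x ↔ ∃ i : ℤ, (fun j : Fin n => x (i + (j : ℕ))) = w := fun w x => by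
    refine exists_congr fun i => ⟨fun h => funext fun j => ?_, fun h j => ?_⟩
    · have := h ⟨j, by simp⟩
      simpa using this
    · have := congrFun h ⟨j, by simpa using j.2⟩
      simpa using this
  ext x
  simp only [Set.mem_ofPred_eq, Finset.mem_image, Set.Finite.mem_toFinset]
  constructor
  · rintro h _ ⟨w, hw, rfl⟩ ho
    obtain ⟨i, rfl⟩ := (occ w x).1 ho
    exact hw (h i)
  · intro h i
    by_contra hc
    exact h _ ⟨_, hc, rfl⟩ ((occ _ x).2 ⟨i, rfl⟩)

lemma globalMap_shift {A : Type*} (m : ℤ) {d : ℕ} (f : (Fin d → A) → A) (c : ℤ) (x : ℤ → A) :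
    globalMap m f (fun i => x (i + c)) = fun i => globalMap m f x (i + c) := by
  funext i
  simp only [globalMap]
  congr 1; funext j; congr 1; ring

lemma globalMap_iterate_shift {A : Type*} (m : ℤ) {d : ℕ} (f : (Fin d → A) → A) (c : ℤ) (j : ℕ)
    (x : ℤ → A) :
    (globalMap m f)^[j] (fun i => x (i + c)) = fun i => (globalMap m f)^[j] x (i + c) := by
  induction j generalizing x with
  | zero => rfl
  | succ j ih => rw [Function.iterate_succ_apply, globalMap_shift, ih, Function.iterate_succ_apply]

/-! ### Simulation of `g` on concatenations of marked blocks. -/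

section simulation
variable {A : Type*} {k r : ℕ} {B : Set (Fin k → A)} (g : (Fin 2 → B) → B)
  (s : Fin (r + 1) → ℕ → A)

/-- The configuration with block boundaries in `-o + blockLength * ℤ`, whose markers spell the
letters of the columns `s` at time `t`, and whose data is `b`. -/
def config (o : ℤ) (t : ℕ) (b : ℤ → B) (i : ℤ) : A :=
  block (fun c => s c t) (b ((i + o) / blockLength k r) : Fin k → A)
    ((i + o) % blockLength k r).toNat

/-- The window `w` appears in some `config`, and `out` is the next state of the cell at position
`blockLength` in the window. -/
def IsStep (w : Fin (4 * blockLength k r) → A) (out : A) : Prop :=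
  ∃ (t : ℕ) (b : ℕ → B) (q : ℕ), q < blockLength k r ∧
    (∀ p, w p = blocks (fun c => s c t) (fun j => (b j : Fin k → A)) (p + q)) ∧
    out = block (fun c => s c (t + 1)) (g ![b 1, b 2] : Fin k → A) q

variable {g s}

lemma row_succ_eq (hs : ∀ c, ∃ c', ∀ t, s c (t + 1) = s c' t) {t t' : ℕ}
    (h : (fun c => s c t) = fun c => s c t') :
    (fun c => s c (t + 1)) = fun c => s c (t' + 1) := by
  funext c
  obtain ⟨c', hc'⟩ := hs c
  rw [hc', hc', congrFun h c']

lemma row_succ_const (hs : ∀ c, ∃ c', ∀ t, s c (t + 1) = s c' t) {t : ℕ} {a : A}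
    (h : ∀ c, s c t = a) (c) : s c (t + 1) = a := by
  obtain ⟨c', hc'⟩ := hs c
  rw [hc', h]

/-- The window determines the phase, the row and the data of the two blocks to which `g` is applied;
the row determines its successor although the time `t` itself is not visible. In the degenerate case
everything is the same constant. -/
theorem IsStep.unique (hs : ∀ c, ∃ c', ∀ t, s c (t + 1) = s c' t)
    (H : (∀ t, ∃ c, s c t ≠ s 0 t) ∨ k = 0) {w : Fin (4 * blockLength k r) → A} {out out' : A}
    (h : IsStep g s w out) (h' : IsStep g s w out') : out = out' := by
  obtain ⟨t, b, q, hq, hw, rfl⟩ := h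
  obtain ⟨t', b', q', hq', hw', rfl⟩ := h'
  have hP := blockLength_pos k r
  have heq : ∀ p < 4 * blockLength k r, blocks (fun c => s c t) (fun j => (b j : Fin k → A))
      (p + q) = blocks (fun c => s c t') (fun j => (b' j : Fin k → A)) (p + q') := fun p hp => by
    rw [← hw ⟨p, hp⟩, ← hw' ⟨p, hp⟩]
  obtain ⟨hrow, hor⟩ := blocks_recognizable (H.imp_left fun h => h t) (H.imp_left fun h => h t')
    hq.le hq'.le fun p hp => heq p (by omega)
  rcases hor with hmod | ⟨hk, hc⟩
  · have hqq : q = q' := by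
      have := hmod
      rwa [Nat.ModEq, Nat.mod_eq_of_lt hq, Nat.mod_eq_of_lt hq'] at this
    subst hqq
    -- Blocks 1 and 2 start `blockLength - q` cells into the window and end before its last cell, so
    -- their data is entirely visible.
    have hb : ∀ j, 1 ≤ j → j < 3 → b j = b' j := fun j h1 h3 => by
      apply Subtype.ext; funext i
      have hM : markerLength k r + i < blockLength k r := by
        unfold blockLength; omega
      have h2 : j * blockLength k r ≤ 2 * blockLength k r := Nat.mul_le_mul_right _ (by omega)
      have h4 : 1 * blockLength k r ≤ j * blockLength k r := Nat.mul_le_mul_right _ (by omega)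
      have := heq (j * blockLength k r + (markerLength k r + i) - q) (by omega)
      rw [Nat.sub_add_cancel (by omega), blocks_add _ _ _ hM, blocks_add _ _ _ hM, block_data,
        block_data] at this
      exact this
    rw [row_succ_eq hs hrow, hb 1 le_rfl (by omega), hb 2 (by omega) (by omega)]
  · have hc' : ∀ c, s c t' = s 0 t := fun c => (congrFun hrow c).symm.trans (hc c)
    rw [block_const _ _ (row_succ_const hs hc) hk, block_const _ _ (row_succ_const hs hc') hk]

variable (g s) in
lemma isStep_config (o : ℤ) (t : ℕ) (b : ℤ → B) (i : ℤ) :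
    IsStep g s (fun j => config s o t b (i - blockLength k r + (j : ℕ)))
      (config s o (t + 1) (globalMap 0 g b) i) := by
  have hP : (0 : ℤ) < blockLength k r := by exact_mod_cast blockLength_pos k r
  obtain ⟨P, hPdef⟩ : ∃ P, blockLength k r = P := ⟨_, rfl⟩
  rw [hPdef] at hP
  refine ⟨t, fun j => b ((i + o) / P - 1 + j), ((i + o) % P).toNat, ?_, fun p => ?_, ?_⟩
  · rw [hPdef]
    have := Int.emod_lt_of_pos (i + o) hP
    omega
  · have h1 : i - P + (p : ℕ) + o = ((p + ((i + o) % P).toNat : ℕ) : ℤ) + P * ((i + o) / P - 1) := by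
      have e1 := Int.emod_nonneg (i + o) hP.ne'
      have e2 := Int.emod_add_mul_ediv (i + o) P
      push_cast
      rw [Int.toNat_of_nonneg e1, mul_sub]
      linarith
    simp only [config, blocks, hPdef]
    rw [h1, Int.add_mul_ediv_left _ _ hP.ne', Int.add_mul_emod_self_left]
    congr 2
    rw [add_comm]; push_cast; rfl
  · simp only [config, globalMap, hPdef]
    congr 2
    apply congrArg
    funext j
    fin_cases j
    · simp
    · simp; congr 1; ring

/-- Consecutive windows share at least three block lengths, so recognizability gives them the same
row and phases that increase by one modulo the block length: the local decompositions glue to a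
global one. -/
lemma exists_config_of_isStep (H : (∀ t, ∃ c, s c t ≠ s 0 t) ∨ k = 0) {x : ℤ → A}
    (hx : ∀ i : ℤ, ∃ out, IsStep g s (fun j => x (i + (j : ℕ))) out) :
    ∃ (o : ℤ) (t : ℕ) (b : ℤ → B), x = config s o t b := by
  have hP := blockLength_pos k r
  have hPz : (0 : ℤ) < blockLength k r := by exact_mod_cast hP
  simp only [IsStep] at hx
  choose out t b q hq hw hout using hx
  clear hout
  replace hx : ∀ (i : ℤ) (p : ℕ), p < 4 * blockLength k r → x (i + p) =
      blocks (fun c => s c (t i)) (fun j => (b i j : Fin k → A)) (p + q i) :=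
    fun i p hp => hw i ⟨p, hp⟩
  have step : ∀ i : ℤ, (fun c => s c (t i)) = (fun c => s c (t (i + 1))) ∧
      (q i + 1 ≡ q (i + 1) [MOD blockLength k r] ∨ k = 0 ∧ ∀ c, s c (t i) = s 0 (t i)) := fun i => by
    refine blocks_recognizable (d := fun j => (b i j : Fin k → A))
      (d' := fun j => (b (i + 1) j : Fin k → A)) (H.imp_left fun h => h _)
      (H.imp_left fun h => h _) (hq i) (hq _).le fun p hp => ?_
    rw [← hx (i + 1) p (by omega), show p + (q i + 1) = p + 1 + q i by omega,
      ← hx i (p + 1) (by omega)]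
    congr 1; push_cast; ring
  have hrow : ∀ i, (fun c => s c (t i)) = fun c => s c (t 0) := fun i => by
    induction i using Int.induction_on with
    | zero => rfl
    | succ i ih => rw [← (step i).1, ih]
    | pred i ih => rw [(step (-i - 1)).1, sub_add_cancel, ih]
  -- In this degenerate case the phases carry no information, but `x` is constant and any boundaries
  -- will do.
  by_cases hc : k = 0 ∧ ∀ c, s c (t 0) = s 0 (t 0)
  · refine ⟨0, t 0, fun _ => b 0 0, funext fun i => ?_⟩
    have := hx i 0 (by omega)
    rw [Nat.cast_zero, add_zero, hrow, blocks, block_const _ _ hc.2 hc.1] at this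
    rw [this, config, block_const _ _ hc.2 hc.1]
  · have hq1 : ∀ i, (q (i + 1) : ℤ) ≡ q i + 1 [ZMOD blockLength k r] := fun i => by
      have h1 := (step i).2.resolve_right fun h => hc ⟨h.1, fun c => by
        rw [← congrFun (hrow i) c, ← congrFun (hrow i) 0]; exact h.2 c⟩
      have := (Int.natCast_modEq_iff.2 h1).symm
      exact_mod_cast this
    have hq2 : ∀ i : ℤ, (q i : ℤ) ≡ i + q 0 [ZMOD blockLength k r] := fun i => by
      induction i using Int.induction_on with
      | zero => simp
      | succ i ih =>
        have := (hq1 i).trans (ih.add_right 1)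
        rwa [show (i : ℤ) + q 0 + 1 = i + 1 + q 0 by ring] at this
      | pred i ih =>
        have h2 := hq1 (-i - 1)
        rw [sub_add_cancel] at h2
        have := (h2.symm.trans ih).sub_right 1
        rwa [add_sub_cancel_right, show -(i : ℤ) + q 0 - 1 = -i - 1 + q 0 by ring] at this
    have hq3 : ∀ i : ℤ, (q i : ℤ) = (i + q 0) % blockLength k r := fun i => by
      rw [← (hq2 i), Int.emod_eq_of_lt (by omega) (by exact_mod_cast hq i)]
    -- The data of block `j` is read in the window that starts at its left boundary, where the phase
    -- is `0`.
    refine ⟨q 0, t 0, fun j => b (j * blockLength k r - q 0) 0, funext fun i => ?_⟩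
    set J := (i + q 0) / (blockLength k r : ℤ) with hJ
    have e0 : q (J * blockLength k r - q 0) = 0 := by
      have := hq3 (J * blockLength k r - q 0)
      rw [sub_add_cancel, Int.mul_emod_left] at this
      exact_mod_cast this
    have e1 := Int.emod_nonneg (i + q 0) hPz.ne'
    have e2 := Int.emod_add_mul_ediv (i + q 0) (blockLength k r)
    have e3 := Int.emod_lt_of_pos (i + q 0) hPz
    have e4 : ((i + q 0) % (blockLength k r : ℤ)).toNat < blockLength k r := by omega
    have := hx (J * blockLength k r - q 0) ((i + q 0) % (blockLength k r : ℤ)).toNat (by omega)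
    rw [hrow, e0, add_zero] at this
    have e5 := blocks_add (fun c => s c (t 0))
      (fun j => (b (J * blockLength k r - q 0) j : Fin k → A)) 0 e4
    rw [zero_mul, zero_add] at e5
    rw [e5, Int.toNat_of_nonneg e1] at this
    rw [show i = J * blockLength k r - q 0 + (i + q 0) % (blockLength k r : ℤ) by
      rw [hJ, mul_comm]; linarith, this]
    rw [show J * blockLength k r - q 0 + (i + q 0) % (blockLength k r : ℤ) = i by
      rw [hJ, mul_comm]; linarith]
    rfl

lemma column_add (hs : ∀ c, ∃ c', ∀ t, s c (t + 1) = s c' t) (t : ℕ) (c) :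
    ∃ c', ∀ j, s c (t + j) = s c' j := by
  induction t generalizing c with
  | zero => exact ⟨c, fun j => by rw [zero_add]⟩
  | succ t ih =>
    obtain ⟨c', hc'⟩ := hs c
    obtain ⟨c'', hc''⟩ := ih c'
    exact ⟨c'', fun j => by rw [← hc'', ← hc']; congr 1; ring⟩

lemma exists_markerIndex (k : ℕ) (c : Fin (r + 1)) :
    ∃ p, ∃ h : p < markerLength k r, (⟨markerIndex k r p, markerIndex_lt h⟩ : Fin (r + 1)) = c := by
  by_cases hc : (c : ℕ) = 0
  · exact ⟨0, markerLength_pos k r, by ext; simp [markerIndex_init, hc]⟩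
  · refine ⟨_, seg_lt (c := 0) c.2 (Nat.succ_pos r), ?_⟩
    ext
    simp only [markerIndex_seg k r c 0 (Nat.succ_pos r)]
    exact if_pos (by omega)

/-- The cellular automaton `g` on blocks of data, with markers evolving along the columns `s`,
is simulated on the configurations of blocks. -/
theorem partiallyTraces_of_isStep [Finite A] [Nonempty B]
    (hs : ∀ c, ∃ c', ∀ t, s c (t + 1) = s c' t)
    (H : (∀ t, ∃ c, s c t ≠ s 0 t) ∨ k = 0) {f : (Fin (4 * blockLength k r) → A) → A}
    (hf : ∀ w out, IsStep g s w out → f w = out) :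
    PartiallyTraces (blockLength k r) f
      {x | ∀ i : ℤ, ∃ out, IsStep g s (fun j => x (i + (j : ℕ))) out}
      (Set.range s ∪ polytrace g) := by
  have hP := blockLength_pos k r
  have hPz : (0 : ℤ) < blockLength k r := by exact_mod_cast hP
  have hmap : ∀ o t (b : ℤ → B), globalMap (blockLength k r : ℤ) f (config s o t b) =
      config s o (t + 1) (globalMap 0 g b) := fun o t b =>
    funext fun i => hf _ _ (isStep_config g s o t b i)
  have hit : ∀ j o t (b : ℤ → B), (globalMap (blockLength k r : ℤ) f)^[j] (config s o t b) =
      config s o (t + j) ((globalMap 0 g)^[j] b) := fun j => by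
    induction j with
    | zero => intros; rfl
    | succ j ih =>
      intro o t b
      rw [Function.iterate_succ_apply, hmap, ih, Function.iterate_succ_apply, add_right_comm,
        add_assoc]
  have hΓ : ∀ o t (b : ℤ → B), config s o t b ∈
      {x : ℤ → A | ∀ i : ℤ, ∃ out, IsStep g s (fun j => x (i + (j : ℕ))) out} := fun o t b i => by
    have := isStep_config g s o t b (i + blockLength k r)
    rw [add_sub_cancel_right] at this
    exact ⟨_, this⟩
  refine ⟨by omega, isSFT_of_windows fun w => ∃ out, IsStep g s w out, fun x hx => ?_, ?_⟩
  · obtain ⟨o, t, b, rfl⟩ := exists_config_of_isStep H hx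
    rw [hmap]
    exact hΓ _ _ _
  · apply Set.Subset.antisymm
    · rintro _ ⟨x, hx, rfl⟩
      obtain ⟨o, t, b, rfl⟩ := exists_config_of_isStep H hx
      have e1 := Int.emod_nonneg o hPz.ne'
      have e3 := Int.emod_lt_of_pos o hPz
      simp only [hit, config, zero_add]
      set p := (o % (blockLength k r : ℤ)).toNat with hp
      have hpP : p < blockLength k r := by omega
      -- A marker cell displays a column from time `t` on, which is again a column; a data cell
      -- displays a component of an orbit of `g`.
      by_cases hpM : p < markerLength k r
      · left
        obtain ⟨c', hc'⟩ := column_add hs t ⟨markerIndex k r p, markerIndex_lt hpM⟩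
        exact ⟨c', funext fun j => by rw [block_marker _ _ hpM, hc']⟩
      · right
        have hi : p - markerLength k r < k := by
          unfold blockLength at hpP; omega
        refine Set.mem_iUnion.2 ⟨⟨_, hi⟩, _, ⟨fun i => b (i + o / blockLength k r), trivial, rfl⟩, ?_⟩
        funext j
        have := block_data (fun c => s c (t + j))
          ((globalMap 0 g)^[j] b (o / blockLength k r) : Fin k → A) ⟨_, hi⟩
        simp only at this
        rw [Nat.add_sub_cancel' (by omega)] at this
        rw [this]
        simp only [globalMap_iterate_shift, zero_add]
    · rintro _ (⟨c, rfl⟩ | hz)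
      · obtain ⟨p, hp, hpc⟩ := exists_markerIndex k c
        obtain ⟨b⟩ := ‹Nonempty B›
        refine ⟨config s p 0 fun _ => b, hΓ _ _ _, funext fun j => ?_⟩
        have hp' := hp.trans_le (markerLength_le k r)
        have e : ((p : ℤ) % (blockLength k r : ℤ)).toNat = p := by
          rw [Int.emod_eq_of_lt (by omega) (by omega)]; rfl
        simp only [hit, config, zero_add, e, block_marker _ _ hp, hpc]
      · obtain ⟨i, _, ⟨b, -, rfl⟩, rfl⟩ := Set.mem_iUnion.1 hz
        refine ⟨config s (markerLength k r + i : ℕ) 0 b, hΓ _ _ _, funext fun j => ?_⟩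
        have hp' : markerLength k r + i < blockLength k r := by
          unfold blockLength; omega
        have e : ((markerLength k r + i : ℕ) : ℤ) % (blockLength k r : ℤ) =
            (markerLength k r + i : ℕ) := Int.emod_eq_of_lt (by omega) (by exact_mod_cast hp')
        have e' : ((markerLength k r + i : ℕ) : ℤ) / (blockLength k r : ℤ) = 0 :=
          Int.ediv_eq_zero_of_lt (by omega) (by exact_mod_cast hp')
        simp only [hit, config, zero_add, e, e', Int.toNat_natCast, block_data]

end simulation

/-! ### Cellular automata all of whose traces are almost everywhere quiescent -/

section nilpotency
variable {X : Type*} (h : X → X → X)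

/-- The one-sided cellular automaton with a local rule of diameter `2`. -/
def rightMap (x : ℕ → X) (i : ℕ) : X := h (x i) (x (i + 1))

lemma rightMap_iterate_congr {x y : ℕ → X} {i t : ℕ} (hxy : ∀ j ≤ t, x (i + j) = y (i + j)) :
    (rightMap h)^[t] x i = (rightMap h)^[t] y i := by
  induction t generalizing x y i with
  | zero => exact hxy 0 le_rfl
  | succ t ih =>
    refine ih fun j hj => ?_
    simp only [rightMap]
    rw [hxy j (by omega), add_assoc, hxy (j + 1) (by omega)]

variable {h} {z : X}

lemma rightMap_iterate_quiescent (hz : h z z = z) {x : ℕ → X} {i t : ℕ}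
    (hx : ∀ j ≤ t, x (i + j) = z) : (rightMap h)^[t] x i = z := by
  rw [rightMap_iterate_congr h (y := fun _ => z) hx,
    Function.iterate_fixed (show rightMap h (fun _ => z) = fun _ => z from funext fun _ => hz)]

lemma exists_bound_of_card_le {P : ℕ → Prop} {M : ℕ}
    (hM : ∀ F : Finset ℕ, (∀ t ∈ F, P t) → F.card ≤ M) : ∃ T, ∀ t, T ≤ t → ¬ P t := by
  have hfin : {t | P t}.Finite := by
    by_contra hc
    obtain ⟨F, hF, hcard⟩ := Set.Infinite.exists_subset_card_eq hc (M + 1)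
    have := hM F fun t ht => hF ht
    omega
  obtain ⟨T, hT⟩ := hfin.bddAbove
  exact ⟨T + 1, fun t ht hp => by have := hT hp; omega⟩

/-- If every cell leaves the quiescent state `z` at most `M` times, then every cell is
quiescent from some uniformly bounded time on. -/
theorem rightMap_nilpotent {M : ℕ}
    (hM : ∀ (x : ℕ → X) (i : ℕ) (F : Finset ℕ),
      (∀ t ∈ F, (rightMap h)^[t] x i ≠ z) → F.card ≤ M) (hz : h z z = z) :
    ∃ N, ∀ (x : ℕ → X) (t : ℕ), N ≤ t → (rightMap h)^[t] x 0 = z := by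
  classical
  by_contra hcon
  push Not at hcon
  -- far away finite configurations reach cell `0`
  have far : ∀ D, ∃ (y : ℕ → X) (E t : ℕ), (∀ i < D, y i = z) ∧ (∀ i, E ≤ i → y i = z) ∧
      (rightMap h)^[t] y 0 ≠ z := fun D => by
    obtain ⟨x, t, ht, hx⟩ := hcon (D * M + 1)
    -- The first `D` cells are active at most `D * M` times altogether, fewer than the `t` times
    -- before `t`.
    have : ∃ t₀ < t, ∀ i < D, (rightMap h)^[t₀] x i = z := by
      by_contra hc
      push Not at hc
      have hsub : Finset.range t ⊆ (Finset.range D).biUnion fun i =>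
          (Finset.range t).filter fun t₀ => (rightMap h)^[t₀] x i ≠ z := fun t₀ ht₀ => by
        obtain ⟨i, hi, hne⟩ := hc t₀ (Finset.mem_range.1 ht₀)
        exact Finset.mem_biUnion.2 ⟨i, Finset.mem_range.2 hi, Finset.mem_filter.2 ⟨ht₀, hne⟩⟩
      have h1 := Finset.card_le_card hsub
      have h2 := Finset.card_biUnion_le_card_mul (Finset.range D) (fun i =>
          (Finset.range t).filter fun t₀ => (rightMap h)^[t₀] x i ≠ z) M
          fun i _ => hM x i _ fun t₀ ht₀ => (Finset.mem_filter.1 ht₀).2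
      simp only [Finset.card_range] at h1 h2
      omega
    obtain ⟨t₀, ht₀, hq⟩ := this
    -- In the remaining `t - t₀` steps cell `0` sees no cell beyond `t - t₀`, so these can be
    -- erased.
    refine ⟨fun i => if i ≤ t - t₀ then (rightMap h)^[t₀] x i else z, t - t₀ + 1, t - t₀,
      fun i hi => ?_, fun i hi => if_neg (by omega), ?_⟩
    · dsimp only
      split_ifs
      exacts [hq i hi, rfl]
    · rw [rightMap_iterate_congr h (y := (rightMap h)^[t₀] x)
        fun j hj => if_pos (by omega), ← Function.iterate_add_apply, Nat.sub_add_cancel ht₀.le]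
      exact hx
  -- Activity accumulates: a finite configuration dies out by some time `T`, and a second one placed
  -- far enough to the right reaches cell `0` only afterwards. With `m = M + 1` this contradicts the
  -- bound.
  have many : ∀ m, ∃ (y : ℕ → X) (E : ℕ) (F : Finset ℕ), (∀ i, E ≤ i → y i = z) ∧ F.card = m ∧
      ∀ t ∈ F, (rightMap h)^[t] y 0 ≠ z := fun m => by
    induction m with
    | zero => exact ⟨fun _ => z, 0, ∅, fun _ _ => rfl, rfl, by simp⟩
    | succ m ih =>
      obtain ⟨y₁, E, F, hE, hF, hact⟩ := ih
      obtain ⟨T, hT⟩ : ∃ T, ∀ t, T ≤ t → ∀ i, (rightMap h)^[t] y₁ i = z := by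
        have hex : ∀ i, ∃ T, ∀ t, T ≤ t → (rightMap h)^[t] y₁ i = z := fun i => by
          obtain ⟨T, hT⟩ := exists_bound_of_card_le (hM y₁ i)
          exact ⟨T, fun t ht => not_not.1 (hT t ht)⟩
        choose T hT using hex
        refine ⟨(Finset.range E).sup T, fun t ht i => ?_⟩
        by_cases hi : i < E
        · exact hT i t ((Finset.le_sup (Finset.mem_range.2 hi)).trans ht)
        · exact rightMap_iterate_quiescent hz fun j _ => hE _ (by omega)
      obtain ⟨y₂, E', t', hD, hE', ht'⟩ := far (E + T + 1)
      have ht'T : T ≤ t' := by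
        by_contra hlt
        exact ht' (rightMap_iterate_quiescent hz fun j hj => hD _ (by omega))
      let y : ℕ → X := fun i => if i < E + T + 1 then y₁ i else y₂ i
      have hy1 : ∀ i < E + T + 1, y i = y₁ i := fun i hi => if_pos hi
      have hy2 : ∀ i, E ≤ i → y i = y₂ i := fun i hi => by
        by_cases hi' : i < E + T + 1
        · rw [hy1 i hi', hE i hi, hD i hi']
        · exact if_neg hi'
      -- At time `T` the cells left of `E` have followed `y₁` and are quiescent, as they are for
      -- `y₂`; the other cells have seen only `y₂`.
      have hyT : (rightMap h)^[T] y = (rightMap h)^[T] y₂ := by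
        funext i
        by_cases hi : i < E
        · rw [rightMap_iterate_congr h (y := y₁) fun j hj => hy1 _ (by omega), hT T le_rfl,
            rightMap_iterate_quiescent hz fun j hj => hD _ (by omega)]
        · exact rightMap_iterate_congr h fun j hj => hy2 _ (by omega)
      refine ⟨y, E + E', insert t' F, fun i hi => ?_, ?_, fun t ht => ?_⟩
      · rw [hy2 i (by omega), hE' i (by omega)]
      · rw [Finset.card_insert_of_notMem, hF]
        exact fun hmem => hact _ hmem (hT _ ht'T _)
      · rcases Finset.mem_insert.1 ht with rfl | ht
        · rw [← Nat.sub_add_cancel ht'T, Function.iterate_add_apply, hyT,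
            ← Function.iterate_add_apply, Nat.sub_add_cancel ht'T]
          exact ht'
        · have htT : t < T := by
            by_contra hlt
            exact hact t ht (hT t (not_lt.1 hlt) 0)
          rw [rightMap_iterate_congr h (y := y₁) fun j hj => hy1 _ (by omega)]
          exact hact t ht
  obtain ⟨y, E, F, -, hF, hact⟩ := many (M + 1)
  have := hM y 0 F hact
  omega

end nilpotency

lemma globalMap_iterate_right {X : Type*} (g : (Fin 2 → X) → X) (j : ℕ) (x : ℤ → X) (i : ℕ) :
    (globalMap 0 g)^[j] x i = (rightMap fun a b => g ![a, b])^[j] (fun i : ℕ => x i) i := by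
  induction j generalizing x i with
  | zero => rfl
  | succ j ih =>
    rw [Function.iterate_succ_apply, ih, Function.iterate_succ_apply]
    refine congrFun (congrArg _ (funext fun i => ?_)) i
    simp only [globalMap, rightMap]
    congr 1; funext c
    fin_cases c <;> simp

/-- A polytrace whose sequences have boundedly many letters other than `a` is nilpotent. -/
theorem polytrace_nilpotent {A : Type*} {k : ℕ} {B : Set (Fin k → A)} (g : (Fin 2 → B) → B)
    {a : A} {M : ℕ}
    (hM : ∀ z ∈ polytrace g, ∀ F : Finset ℕ, (∀ t ∈ F, z t ≠ a) → F.card ≤ M) :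
    ∃ N, ∀ z ∈ polytrace g, ∀ t, N ≤ t → z t = a := by
  classical
  rcases isEmpty_or_nonempty B with hB | hB
  · refine ⟨0, fun z hz => ?_⟩
    obtain ⟨q, _, ⟨x, -, rfl⟩, rfl⟩ := Set.mem_iUnion.1 hz
    exact (hB.false (x 0)).elim
  have hcard : ∀ (x : ℤ → B) (F : Finset ℕ),
      (∀ t ∈ F, ((globalMap 0 g)^[t] x 0 : Fin k → A) ≠ fun _ => a) → F.card ≤ k * M :=
    fun x F hF => by
      have hsub : F ⊆ Finset.univ.biUnion fun q : Fin k =>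
          F.filter fun t => ((globalMap 0 g)^[t] x 0 : Fin k → A) q ≠ a := fun t ht => by
        obtain ⟨q, hq⟩ := Function.ne_iff.1 (hF t ht)
        exact Finset.mem_biUnion.2 ⟨q, Finset.mem_univ _, Finset.mem_filter.2 ⟨ht, hq⟩⟩
      have h2 := Finset.card_biUnion_le_card_mul Finset.univ (fun q : Fin k =>
          F.filter fun t => ((globalMap 0 g)^[t] x 0 : Fin k → A) q ≠ a) M fun q _ =>
        hM (fun t => ((globalMap 0 g)^[t] x 0 : Fin k → A) q)
          (Set.mem_iUnion.2 ⟨q, _, ⟨x, trivial, rfl⟩, rfl⟩) _ fun t ht => (Finset.mem_filter.1 ht).2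
      rw [Finset.card_univ, Fintype.card_fin] at h2
      exact (Finset.card_le_card hsub).trans h2
  -- A quiescent state is needed: the orbit of a constant configuration stays constant and
  -- eventually displays only `a`, so the word constantly equal to `a` is a letter of `B` fixed by
  -- `g`.
  obtain ⟨b⟩ := hB
  obtain ⟨T, hT⟩ := exists_bound_of_card_le (hcard fun _ => b)
  have hcc : ∀ c : B, globalMap 0 g (fun _ => c) = fun _ => g fun _ => c := fun c => rfl
  have hconst : ∀ t, ∃ c : B, (globalMap 0 g)^[t] (fun _ => b) = fun _ => c := fun t => by
    induction t with
    | zero => exact ⟨b, rfl⟩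
    | succ t ih =>
      obtain ⟨c, hc⟩ := ih
      exact ⟨_, by rw [Function.iterate_succ_apply', hc, hcc]⟩
  obtain ⟨z, hz⟩ := hconst T
  have hza : (z : Fin k → A) = fun _ => a := by
    have := not_not.1 (hT T le_rfl)
    rwa [hz] at this
  have hzz : g ![z, z] = z := by
    have h1 := not_not.1 (hT (T + 1) (by omega))
    rw [Function.iterate_succ_apply', hz, hcc, ← hza] at h1
    refine (congrArg g (funext fun i => ?_)).trans (Subtype.ext h1)
    fin_cases i <;> rfl
  obtain ⟨N, hN⟩ := rightMap_nilpotent (h := fun a b => g ![a, b]) (z := z) (M := k * M)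
    (fun x i F hF => by
      -- Moving cell `i` to the origin, `toNat` fills the cells on the far left arbitrarily; the
      -- orbit of a cell depends only on the cells to its right.
      refine hcard (fun j => x (j + i).toNat) F fun t ht hc => hF t ht ?_
      apply Subtype.ext
      rw [hza, ← hc]
      have h1 := globalMap_iterate_shift 0 g i t fun j => x j.toNat
      have h2 := congrFun h1 0
      rw [zero_add, globalMap_iterate_right] at h2
      simp only [Int.toNat_natCast] at h2
      exact congrArg Subtype.val h2.symm) hzz
  refine ⟨N, fun y hy t ht => ?_⟩
  obtain ⟨q, _, ⟨x, -, rfl⟩, rfl⟩ := Set.mem_iUnion.1 hy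
  have h1 := globalMap_iterate_right g t x 0
  rw [hN _ t ht] at h1
  simp only [Nat.cast_zero] at h1
  simp only [h1, hza]

/-! ### Infinite paths of labelled graphs -/

section paths
variable {A : Type*} {E : Finset (ℕ × A × ℕ)}

def IsPath (E : Finset (ℕ × A × ℕ)) (w : ℕ → ℕ × A × ℕ) : Prop :=
  ∀ i, w i ∈ E ∧ (w i).2.2 = (w (i + 1)).1

lemma mem_rightLabels {z : ℕ → A} :
    z ∈ rightLabels E ↔ ∃ w, IsPath E w ∧ ∀ i, (w i).2.1 = z i := by
  constructor
  · rintro ⟨v, hv⟩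
    exact ⟨fun i => (v i, z i, v (i + 1)), fun i => ⟨hv i, rfl⟩, fun i => rfl⟩
  · rintro ⟨w, hw, hz⟩
    refine ⟨fun i => (w i).1, fun i => ?_⟩
    dsimp only
    rw [← hz, ← (hw i).2]
    exact (hw i).1

lemma IsPath.shift {w : ℕ → ℕ × A × ℕ} (hw : IsPath E w) (c : ℕ) :
    IsPath E fun i => w (i + c) := fun i => by
  have := hw (i + c)
  rwa [add_right_comm] at this

lemma shift_mem_rightLabels {z : ℕ → A} (hz : z ∈ rightLabels E) (c : ℕ) :
    (fun i => z (i + c)) ∈ rightLabels E := by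
  obtain ⟨w, hw, h⟩ := mem_rightLabels.1 hz
  exact mem_rightLabels.2 ⟨_, hw.shift c, fun i => h _⟩

/-- A finite path with a repeated edge extends to an ultimately periodic infinite path. -/
lemma exists_lasso {e : ℕ → ℕ × A × ℕ} {i j : ℕ} (hij : i < j) (heq : e i = e j)
    (he : ∀ t < j, e t ∈ E ∧ (e t).2.2 = (e (t + 1)).1) :
    ∃ w, IsPath E w ∧ (∀ t < j, w t = e t) ∧ ∀ t, i ≤ t → w (t + (j - i)) = w t := by
  have hpos : 0 < j - i := by omega
  refine ⟨fun t => e (if t < i then t else i + (t - i) % (j - i)), fun t => ?_, fun t ht => ?_,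
    fun t ht => ?_⟩
  · dsimp only
    by_cases h1 : t + 1 < i
    · rw [if_pos h1, if_pos (by omega)]
      exact he t (by omega)
    · rw [if_neg h1]
      by_cases h2 : t < i
      · rw [if_pos h2]
        have : t + 1 - i = 0 := by omega
        rw [this, Nat.zero_mod, add_zero]
        have h3 := he t (by omega)
        rwa [show t + 1 = i by omega] at h3
      · rw [if_neg h2]
        have hm := Nat.mod_lt (t - i) hpos
        have h3 := he (i + (t - i) % (j - i)) (by omega)
        refine ⟨h3.1, ?_⟩
        rw [h3.2]
        by_cases h4 : (t - i) % (j - i) + 1 = j - i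
        · have h5 : (t + 1 - i) % (j - i) = 0 := by
            rw [show t + 1 - i = t - i + 1 by omega, Nat.add_mod_eq_ite]
            rcases Nat.lt_or_ge 1 (j - i) with h6 | h6
            · rw [Nat.mod_eq_of_lt h6, if_pos (by omega)]; omega
            · have : j - i = 1 := by omega
              rw [this]; simp [Nat.mod_one]
          rw [h5, add_zero, heq]
          congr 2; omega
        · have h5 : (t + 1 - i) % (j - i) = (t - i) % (j - i) + 1 := by
            rw [show t + 1 - i = t - i + 1 by omega, ← Nat.mod_add_mod, Nat.mod_eq_of_lt (by omega)]
          rw [h5, add_assoc]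
  · by_cases h1 : t < i
    · simp only [if_pos h1]
    · simp only [if_neg h1]
      rw [Nat.mod_eq_of_lt (by omega), Nat.add_sub_cancel' (by omega)]
  · dsimp only
    rw [if_neg (by omega), if_neg (by omega), show t + (j - i) - i = t - i + (j - i) by omega,
      Nat.add_mod_right]

/-- Two closed paths of the same length, the first labels of which differ. -/
def HasDistinctCycles (E : Finset (ℕ × A × ℕ)) : Prop :=
  ∃ (l : ℕ) (w w' : ℕ → ℕ × A × ℕ), 0 < l ∧ IsPath E w ∧ IsPath E w' ∧
    Function.Periodic w l ∧ Function.Periodic w' l ∧ (w 0).2.1 ≠ (w' 0).2.1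

lemma IsPath.exists_repeat {w : ℕ → ℕ × A × ℕ} (hw : IsPath E w) : ∃ i j, i < j ∧ w i = w j := by
  obtain ⟨i, j, hne, h⟩ := Finite.exists_ne_map_eq_of_infinite fun i => (⟨w i, (hw i).1⟩ : E)
  have h : w i = w j := congrArg Subtype.val h
  rcases lt_or_gt_of_ne hne with hlt | hlt
  exacts [⟨i, j, hlt, h⟩, ⟨j, i, hlt, h.symm⟩]

lemma IsPath.exists_periodic {w : ℕ → ℕ × A × ℕ} (hw : IsPath E w) {i j : ℕ} (hij : i < j)
    (h : w i = w j) : ∃ w', IsPath E w' ∧ w' 0 = w i ∧ Function.Periodic w' (j - i) := by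
  obtain ⟨w', hw', h1, h2⟩ := exists_lasso hij h fun t _ => hw t
  refine ⟨fun t => w' (t + i), hw'.shift i, ?_, fun t => ?_⟩
  · simp only [zero_add]; exact h1 i hij
  · dsimp only
    rw [add_right_comm]
    exact h2 _ (by omega)

/-- If all the closed paths carry the same letter, then this letter is almost everywhere in every
label of an infinite path. -/
lemma exists_card_le_of_not_hasDistinctCycles (hE : ¬ HasDistinctCycles E)
    (hne : (rightLabels E).Nonempty) :
    ∃ a, ∀ z ∈ rightLabels E, ∀ F : Finset ℕ, (∀ t ∈ F, z t ≠ a) → F.card ≤ E.card := by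
  obtain ⟨z₀, hz₀⟩ := hne
  obtain ⟨w₀, hw₀, -⟩ := mem_rightLabels.1 hz₀
  obtain ⟨i₀, j₀, hij₀, h₀⟩ := hw₀.exists_repeat
  obtain ⟨w₁, hw₁, -, hp₁⟩ := hw₀.exists_periodic hij₀ h₀
  refine ⟨(w₁ 0).2.1, fun z hz F hF => ?_⟩
  obtain ⟨w, hw, hwz⟩ := mem_rightLabels.1 hz
  have key : ∀ i j, i < j → w i = w j → z i = (w₁ 0).2.1 := fun i j hij h => by
    by_contra hc
    obtain ⟨w₂, hw₂, h0, hp₂⟩ := hw.exists_periodic hij h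
    -- The product of the two periods serves as a common length.
    refine hE ⟨(j₀ - i₀) * (j - i), w₂, w₁, Nat.mul_pos (by omega) (by omega), hw₂, hw₁,
      hp₂.nat_mul _, ?_, ?_⟩
    · rw [mul_comm]; exact hp₁.nat_mul _
    · rwa [h0, hwz]
  -- An edge that recurs later lies on a closed path and has the common letter, so the edges used at
  -- the times of `F` are pairwise distinct.
  refine Finset.card_le_card_of_injOn w (fun t _ => (hw t).1) fun i hi j hj hij => ?_
  by_contra hne
  rcases lt_or_gt_of_ne hne with hlt | hlt
  · exact hF i hi (key i j hlt hij)
  · exact hF j hj (key j i hlt hij.symm)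

theorem hasDistinctCycles_or_nilpotent {k : ℕ} {B : Set (Fin k → A)} (g : (Fin 2 → B) → B)
    (hg : polytrace g = rightLabels E) :
    HasDistinctCycles E ∨ rightLabels E = ∅ ∨
      ∃ N a, ∀ z ∈ rightLabels E, ∀ t, N ≤ t → z t = a := by
  by_cases hE : HasDistinctCycles E
  · exact Or.inl hE
  refine Or.inr ?_
  rcases Set.eq_empty_or_nonempty (rightLabels E) with h | h
  · exact Or.inl h
  obtain ⟨a, ha⟩ := exists_card_le_of_not_hasDistinctCycles hE h
  rw [← hg] at ha ⊢
  obtain ⟨N, hN⟩ := polytrace_nilpotent g ha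
  exact Or.inr ⟨N, a, hN⟩

end paths

/-! ### Columns of the markers -/

section columns
variable {A : Type*}

/-- All the shifts of two sequences of period `l`, interleaved. -/
def cycleColumns (r : ℕ) (u u' : ℕ → A) (c : Fin (r + 1)) (t : ℕ) : A :=
  if (c : ℕ) % 2 = 0 then u (t + c / 2) else u' (t + c / 2)

/-- The parity of `c` selects the sequence and `c / 2` the shift, so the next column is `c + 2`; the
last two columns wrap around by periodicity. -/
lemma cycleColumns_shift {r l : ℕ} (hr : r + 1 = 2 * l) {u u' : ℕ → A}
    (hu : Function.Periodic u l) (hu' : Function.Periodic u' l) (c : Fin (r + 1)) :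
    ∃ c', ∀ t, cycleColumns r u u' c (t + 1) = cycleColumns r u u' c' t := by
  by_cases hc : (c : ℕ) + 2 < r + 1
  · refine ⟨⟨c + 2, hc⟩, fun t => ?_⟩
    simp only [cycleColumns]
    rw [Nat.add_mod_right, show ((c : ℕ) + 2) / 2 = c / 2 + 1 by omega, add_right_comm, add_assoc]
  · refine ⟨⟨c % 2, by omega⟩, fun t => ?_⟩
    simp only [cycleColumns]
    have h1 : (c : ℕ) / 2 + 1 = l := by omega
    have h2 : (c : ℕ) % 2 / 2 = 0 := by omega
    rw [Nat.mod_mod, h2, add_zero, add_assoc, add_comm 1, h1, hu, hu']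

lemma cycleColumns_ne {r l : ℕ} (hr : r + 1 = 2 * l) (hl : 0 < l) {u u' : ℕ → A}
    (hu : Function.Periodic u l) (hu' : Function.Periodic u' l) (hne : u 0 ≠ u' 0) (t : ℕ) :
    ∃ c, cycleColumns r u u' c t ≠ cycleColumns r u u' 0 t := by
  by_contra hcon
  push Not at hcon
  have hm := Nat.mod_lt t hl
  have hd := Nat.mod_add_div t l
  -- This shift completes `t` to a multiple of `l`, so at time `t` the two columns with this shift
  -- display `u 0` and `u' 0`.
  have e1 := hcon ⟨2 * (l - 1 - (t + l - 1) % l), by omega⟩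
  have e2 := hcon ⟨2 * (l - 1 - (t + l - 1) % l) + 1, by omega⟩
  have h1 := Nat.mod_lt (t + l - 1) hl
  have h2 := Nat.mod_add_div (t + l - 1) l
  have h3 : t + (l - 1 - (t + l - 1) % l) = (t + l - 1) / l * l := by
    rw [mul_comm]; omega
  simp only [cycleColumns, Nat.mul_mod_right, if_true, Nat.mul_div_cancel_left _ two_pos,
    show (2 * (l - 1 - (t + l - 1) % l) + 1) % 2 = 1 by omega, one_ne_zero, if_false,
    show (2 * (l - 1 - (t + l - 1) % l) + 1) / 2 = l - 1 - (t + l - 1) % l by omega, h3] at e1 e2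
  have p1 := hu.nat_mul_eq ((t + l - 1) / l)
  have p2 := hu'.nat_mul_eq ((t + l - 1) / l)
  simp only [Nat.cast_id] at p1 p2
  rw [p1] at e1
  rw [p2] at e2
  exact hne (e1.trans e2.symm)

lemma cycleColumns_mem {r : ℕ} {E : Finset (ℕ × A × ℕ)} {u u' : ℕ → A} (hu : u ∈ rightLabels E)
    (hu' : u' ∈ rightLabels E) : Set.range (cycleColumns r u u') ⊆ rightLabels E := by
  rintro _ ⟨c, rfl⟩
  by_cases hc : (c : ℕ) % 2 = 0
  · have := shift_mem_rightLabels hu (c / 2)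
    convert this using 2
    simp [cycleColumns, hc]
  · have := shift_mem_rightLabels hu' (c / 2)
    convert this using 2
    simp [cycleColumns, hc]

lemma polytrace_zero {B : Set (Fin 0 → A)} (g : (Fin 2 → B) → B) : polytrace g = ∅ := by
  simp [polytrace]

lemma isSFT_empty : IsSFT (∅ : Set (ℤ → A)) :=
  ⟨{[]}, by
    ext x
    simp only [Set.mem_empty_iff_false, Finset.mem_singleton, false_iff]
    intro h
    exact h [] rfl ⟨0, fun j => j.elim0⟩⟩

lemma partiallyTraces_empty (m : ℤ) {d : ℕ} (hd : 0 < d) (f : (Fin d → A) → A) :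
    PartiallyTraces m f ∅ (∅ : Set (ℕ → A)) :=
  ⟨hd, isSFT_empty, fun _ h => h.elim, Set.image_empty _⟩

lemma exists_rule_of_isStep {k r : ℕ} {B : Set (Fin k → A)} {g : (Fin 2 → B) → B}
    {s : Fin (r + 1) → ℕ → A} (hs : ∀ c, ∃ c', ∀ t, s c (t + 1) = s c' t)
    (H : (∀ t, ∃ c, s c t ≠ s 0 t) ∨ k = 0) :
    ∃ f : (Fin (4 * blockLength k r) → A) → A, ∀ w out, IsStep g s w out → f w = out := by
  classical
  have hP := blockLength_pos k r
  refine ⟨fun w => if h : ∃ out, IsStep g s w out then h.choose else w ⟨0, by omega⟩,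
    fun w out h => ?_⟩
  dsimp only
  rw [dif_pos ⟨out, h⟩]
  exact IsStep.unique hs H (Exists.choose_spec _) h

lemma columns_shift_of_range_eq {r : ℕ} {E : Finset (ℕ × A × ℕ)} {s : Fin (r + 1) → ℕ → A}
    (hs : Set.range s = rightLabels E) (c) : ∃ c', ∀ t, s c (t + 1) = s c' t := by
  have := shift_mem_rightLabels (hs ▸ Set.mem_range_self c : s c ∈ rightLabels E) 1
  rw [← hs] at this
  obtain ⟨c', hc'⟩ := this
  exact ⟨c', fun t => (congrFun hc' t).symm⟩

theorem isPartiallyTraceable_of_isSofic_of_isPolytraceable [Finite A] {S : Set (ℕ → A)}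
    (hS : IsSofic S) (hp : IsPolytraceable S) : IsPartiallyTraceable S := by
  obtain ⟨E, rfl⟩ := hS
  obtain ⟨k, B, g, hg⟩ := hp
  rcases hasDistinctCycles_or_nilpotent g hg with ⟨l, w, w', hl, hw, hw', hpw, hpw', hne⟩ | h | h
  · have hr : 2 * l - 1 + 1 = 2 * l := by omega
    have hu : Function.Periodic (fun t => (w t).2.1) l := fun t => by dsimp only; rw [hpw]
    have hu' : Function.Periodic (fun t => (w' t).2.1) l := fun t => by dsimp only; rw [hpw']
    have m1 : (fun t => (w t).2.1) ∈ rightLabels E := mem_rightLabels.2 ⟨w, hw, fun _ => rfl⟩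
    have m2 : (fun t => (w' t).2.1) ∈ rightLabels E := mem_rightLabels.2 ⟨w', hw', fun _ => rfl⟩
    have : Nonempty B := by
      have m3 := m1
      rw [← hg] at m3
      obtain ⟨_, _, ⟨x, -, rfl⟩, -⟩ := Set.mem_iUnion.1 m3
      exact ⟨x 0⟩
    have hs := cycleColumns_shift hr hu hu'
    have H := cycleColumns_ne hr hl hu hu' hne
    obtain ⟨f, hf⟩ := exists_rule_of_isStep (g := g) hs (Or.inl H)
    have := partiallyTraces_of_isStep hs (Or.inl H) hf
    rw [hg, Set.union_eq_right.2 (cycleColumns_mem m1 m2)] at this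
    exact ⟨_, _, f, _, this⟩
  · rw [h]
    exact ⟨0, 1, fun w => w 0, ∅, partiallyTraces_empty _ one_pos _⟩
  · obtain ⟨N, a, hN⟩ := h
    rcases Set.eq_empty_or_nonempty (rightLabels E) with h | h
    · rw [h]
      exact ⟨0, 1, fun w => w 0, ∅, partiallyTraces_empty _ one_pos _⟩
    have hfin : (rightLabels E).Finite := by
      refine Set.Finite.of_finite_image (f := fun z (i : Fin N) => z i) (Set.toFinite _)
        fun z hz z' hz' h => funext fun t => ?_
      by_cases ht : t < N
      · exact congrFun h ⟨t, ht⟩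
      · rw [hN z hz t (by omega), hN z' hz' t (by omega)]
    obtain ⟨r, hr⟩ : ∃ r, hfin.toFinset.toList.length = r + 1 := by
      refine Nat.exists_eq_succ_of_ne_zero fun h0 => ?_
      obtain ⟨z, hz⟩ := h
      have : z ∈ hfin.toFinset.toList := by simpa using hz
      rw [List.length_eq_zero_iff.1 h0] at this
      simp at this
    let s : Fin (r + 1) → ℕ → A := fun c => hfin.toFinset.toList.get (Fin.cast hr.symm c)
    have hrange : Set.range s = rightLabels E := by
      ext z
      rw [← hfin.mem_toFinset, ← Finset.mem_toList, List.mem_iff_get]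
      constructor
      · rintro ⟨c, rfl⟩; exact ⟨_, rfl⟩
      · rintro ⟨c, rfl⟩; exact ⟨Fin.cast hr c, rfl⟩
    have hs := columns_shift_of_range_eq hrange
    -- With empty data words the polytrace is empty and the trace consists of the columns alone,
    -- which here enumerate Σ; constant rows are then harmless.
    let g₀ : (Fin 2 → (Set.univ : Set (Fin 0 → A))) → (Set.univ : Set (Fin 0 → A)) := fun b => b 0
    obtain ⟨f, hf⟩ := exists_rule_of_isStep (g := g₀) hs (Or.inr rfl)
    have := partiallyTraces_of_isStep hs (Or.inr rfl) hf
    rw [polytrace_zero, Set.union_empty, hrange] at this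
    exact ⟨_, _, f, _, this⟩

end columns

/-! ### The algorithm -/

def allLists {α : Type*} (l : List α) : ℕ → List (List α)
  | 0 => [[]]
  | m + 1 => l.flatMap fun a => (allLists l m).map fun w => a :: w

lemma mem_allLists {α : Type*} {l : List α} {m : ℕ} {w : List α} :
    w ∈ allLists l m ↔ w.length = m ∧ ∀ a ∈ w, a ∈ l := by
  induction m generalizing w with
  | zero =>
    simp only [allLists, List.mem_singleton, List.length_eq_zero_iff]
    constructor
    · rintro rfl; simp
    · exact fun h => h.1
  | succ m ih =>
    simp only [allLists, List.mem_flatMap, List.mem_map, ih]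
    constructor
    · rintro ⟨a, ha, w, ⟨hw, hm⟩, rfl⟩
      exact ⟨by simp [hw], by simpa using ⟨ha, hm⟩⟩
    · rintro ⟨hl, hm⟩
      cases w with
      | nil => simp at hl
      | cons a w =>
        exact ⟨a, hm a (by simp), w, ⟨by simpa using hl, fun b hb => hm b (by simp [hb])⟩, rfl⟩

def lookupD {α β : Type*} [DecidableEq α] (l : List (α × β)) (a : α) (b : β) : β :=
  (l.lookup a).getD b

/-- A row and its successor. -/
abbrev RowCode : Type := List ℕ × List ℕ

def blockCode (k r : ℕ) (ρ d : List ℕ) (p : ℕ) : ℕ :=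
  if p < markerLength k r then ρ.getD (markerIndex k r p) 0 else d.getD (p - markerLength k r) 0

/-- The list of the windows of length `4 * blockLength k r` with the next state of their cell at
position `blockLength k r`. -/
def stepCode (k r : ℕ) (letters : List (List ℕ)) (table : List ((List ℕ × List ℕ) × List ℕ))
    (rows : List RowCode) : List (List ℕ × ℕ) :=
  -- A window of four block lengths meets at most five blocks.
  rows.flatMap fun ρ => (allLists letters 5).flatMap fun bs =>
    (List.range (blockLength k r)).map fun q =>
      ((List.range (4 * blockLength k r)).map fun p =>
          blockCode k r ρ.1 (bs.getD ((p + q) / blockLength k r) []) ((p + q) % blockLength k r),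
        blockCode k r ρ.2 (lookupD table (bs.getD 1 [], bs.getD 2 []) []) q)

/-- On words that are not legal windows the rule returns the first letter, a default that stays
below `n`. -/
def ruleCode (n d : ℕ) (steps : List (List ℕ × ℕ)) : List (List ℕ × ℕ) :=
  (allLists (List.range n) d).map fun w => (w, lookupD steps w w.headI)

/-- A de Bruijn graph: each legal window is an edge from its prefix to its suffix, both one letter
shorter, labelled by its first letter. -/
def windowGraph (steps : List (List ℕ × ℕ)) : GraphCode :=
  steps.map fun e => (Encodable.encode (e.1.take (e.1.length - 1)), e.1.headI,
    Encodable.encode e.1.tail)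

def output (n k r : ℕ) (letters : List (List ℕ)) (table : List ((List ℕ × List ℕ) × List ℕ))
    (rows : List RowCode) : CACode × GraphCode :=
  (((blockLength k r : ℤ), 4 * blockLength k r,
      ruleCode n (4 * blockLength k r) (stepCode k r letters table rows)),
    windowGraph (stepCode k r letters table rows))

abbrev EdgeCode : Type := ℕ × ℕ × ℕ

def IsClosedWalk (cE c : List EdgeCode) : Prop :=
  ∀ i < c.length, c.getD i (0, 0, 0) ∈ cE ∧
    (c.getD i (0, 0, 0)).2.2 = (c.getD ((i + 1) % c.length) (0, 0, 0)).1

def IsCycleCertificate (cE : List EdgeCode) (c : List EdgeCode × List EdgeCode) : Prop :=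
  0 < c.1.length ∧ c.1.length = c.2.length ∧ IsClosedWalk cE c.1 ∧ IsClosedWalk cE c.2 ∧
    (c.1.getD 0 (0, 0, 0)).2.1 ≠ (c.2.getD 0 (0, 0, 0)).2.1

def cycleRow (c : List EdgeCode × List EdgeCode) (t : ℕ) : List ℕ :=
  (List.range (2 * c.1.length)).map fun i =>
    if i % 2 = 0 then (c.1.getD ((t + i / 2) % c.1.length) (0, 0, 0)).2.1
    else (c.2.getD ((t + i / 2) % c.1.length) (0, 0, 0)).2.1

/-- Rows are periodic in time, so one period lists every row with its successor. -/
def cycleRows (c : List EdgeCode × List EdgeCode) : List RowCode :=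
  (List.range c.1.length).map fun t => (cycleRow c t, cycleRow c (t + 1))

/-- The words of length `N` which are prefixes of labels of infinite paths. -/
def prefixCode (cE : List EdgeCode) (N : ℕ) : List (List ℕ) :=
  -- Among the `cE.length + 1` edges after the prefix one is repeated, so the finite path continues
  -- forever around a loop. This makes extendability decidable.
  ((allLists cE (N + cE.length + 1)).filter fun w => ∀ i < w.length - 1,
    (w.getD i (0, 0, 0)).2.2 = (w.getD (i + 1) (0, 0, 0)).1).map fun w =>
      (w.take N).map fun e => e.2.1

/-- Testing the single position `c.1` suffices: by shift invariance the letter there is then the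
letter at all later positions. -/
def IsNilpotencyCertificate (cE : List EdgeCode) (c : ℕ × ℕ) : Prop :=
  ∀ w ∈ prefixCode cE (c.1 + 1), w.getD c.1 0 = c.2

def nilpotentRow (cE : List EdgeCode) (c : ℕ × ℕ) (t : ℕ) : List ℕ :=
  c.2 :: (prefixCode cE c.1).map fun w => w.getD t c.2

/-- The outer loop only repeats the list, but makes it empty when Σ is empty; the output is then the
empty SFT, whereas the column constantly equal to `c.2` would be wrong. Rows are stationary from
time `c.1` on. -/
def nilpotentRows (cE : List EdgeCode) (c : ℕ × ℕ) : List RowCode :=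
  (prefixCode cE c.1).flatMap fun _ => (List.range (c.1 + 1)).map fun t =>
    (nilpotentRow cE c t, nilpotentRow cE c (t + 1))

def cycleOutput (a : ℕ × PolyCode × GraphCode) (c : List EdgeCode × List EdgeCode) :
    CACode × GraphCode :=
  output a.1 a.2.1.1 (2 * c.1.length - 1) a.2.1.2.1 a.2.1.2.2 (cycleRows c)

def nilpotentOutput (a : ℕ × PolyCode × GraphCode) (c : ℕ × ℕ) : CACode × GraphCode :=
  output a.1 0 (prefixCode a.2.2 c.1).length [[]] [(([], []), [])] (nilpotentRows a.2.2 c)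

-- The index is decoded both as a cycle certificate and as a nilpotency certificate, so running
-- through all indices tries every certificate of either kind.
open Classical in
noncomputable def attempt (a : ℕ × PolyCode × GraphCode) (i : ℕ) : Option (CACode × GraphCode) :=
  ((Encodable.decode (α := List EdgeCode × List EdgeCode) i).bind fun c =>
    if IsCycleCertificate a.2.2 c then some (cycleOutput a c) else none) <|>
  ((Encodable.decode (α := ℕ × ℕ) i).bind fun c =>
    if IsNilpotencyCertificate a.2.2 c then some (nilpotentOutput a c) else none)

/-! ### Correctness -/

lemma mem_wordCode {n k : ℕ} {w : Fin k → Fin n} {a : ℕ} (h : a ∈ wordCode w) : a < n := by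
  obtain ⟨i, rfl⟩ := List.mem_ofFn.1 h
  exact (w i).2

lemma wordCode_length {n k : ℕ} (w : Fin k → Fin n) : (wordCode w).length = k := by
  simp [wordCode]

lemma wordCode_getD {n k : ℕ} (w : Fin k → Fin n) {i : ℕ} (hi : i < k) (a : ℕ) :
    (wordCode w).getD i a = w ⟨i, hi⟩ := by
  simp [wordCode, List.getD, hi]

lemma wordCode_injective {n k : ℕ} : Function.Injective (wordCode : (Fin k → Fin n) → List ℕ) :=
  fun _ _ h => funext fun i => Fin.ext (congrFun (List.ofFn_injective h) i)

lemma exists_wordCode {n k : ℕ} {l : List ℕ} (hl : l.length = k) (h : ∀ a ∈ l, a < n) :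
    ∃ w : Fin k → Fin n, l = wordCode w := by
  subst hl
  refine ⟨fun i => ⟨l.get i, h _ (l.get_mem i)⟩, ?_⟩
  simp [wordCode]

lemma map_range_eq_wordCode {n k : ℕ} {f : ℕ → ℕ} {w : Fin k → Fin n}
    (h : ∀ i : Fin k, f i = w i) : (List.range k).map f = wordCode w := by
  refine List.ext_getElem (by simp [wordCode]) fun i h1 h2 => ?_
  have hi : i < k := by simpa using h1
  simp [wordCode, h ⟨i, hi⟩]

lemma lookupD_of_mem {α β : Type*} [DecidableEq α] {l : List (α × β)} {a : α} {b : β} (d : β)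
    (h : (a, b) ∈ l) (hl : ∀ b', (a, b') ∈ l → b' = b) : lookupD l a d = b := by
  induction l with
  | nil => simp at h
  | cons e l ih =>
    obtain ⟨a', b'⟩ := e
    rw [lookupD, List.lookup_cons]
    by_cases ha : a = a'
    · subst ha
      simp [hl b' (by simp)]
    · have : (a == a') = false := by simpa using ha
      rw [this]
      refine ih ?_ fun b' hb' => hl b' (by simp [hb'])
      simpa [ha] using h

lemma lookupD_eq_or_mem {α β : Type*} [DecidableEq α] (l : List (α × β)) (a : α) (d : β) :
    lookupD l a d = d ∨ (a, lookupD l a d) ∈ l := by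
  induction l with
  | nil => simp [lookupD]
  | cons e l ih =>
    obtain ⟨a', b'⟩ := e
    rw [lookupD, List.lookup_cons]
    by_cases ha : a = a'
    · subst ha
      simp
    · have : (a == a') = false := by simpa using ha
      rw [this]
      exact ih.imp_right (List.mem_cons_of_mem _)

lemma blockCode_eq {n k r : ℕ} (ρ : Fin (r + 1) → Fin n) (d : Fin k → Fin n) {p : ℕ}
    (hp : p < blockLength k r) :
    blockCode k r (wordCode ρ) (wordCode d) p = block ρ d p := by
  by_cases h : p < markerLength k r
  · rw [blockCode, if_pos h, block_marker _ _ h, wordCode_getD]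
  · have hd : p - markerLength k r < k := by unfold blockLength at hp; omega
    rw [blockCode, if_neg h, block, if_neg h, dif_pos hd, wordCode_getD]

section
variable {n k r : ℕ} {B : Set (Fin k → Fin n)} {g : (Fin 2 → B) → B} {cG : PolyCode}
  {s : Fin (r + 1) → ℕ → Fin n} {rows : List RowCode}

lemma lookup_table (hG : cG.Represents g) (b : Fin 2 → B) :
    lookupD cG.2.2 (wordCode (b 0 : Fin k → Fin n), wordCode (b 1 : Fin k → Fin n)) [] =
      wordCode (g b : Fin k → Fin n) := by
  refine lookupD_of_mem _ ((hG.2.2 _).2 ⟨b, rfl⟩) fun c hc => ?_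
  obtain ⟨b', hb'⟩ := (hG.2.2 _).1 hc
  simp only [Prod.mk.injEq] at hb'
  obtain ⟨⟨h0, h1⟩, rfl⟩ := hb'
  have : b = b' := funext fun i => by
    apply Subtype.ext
    fin_cases i
    exacts [wordCode_injective h0, wordCode_injective h1]
  rw [this]

lemma mem_letters (hG : cG.Represents g) {bs : List (List ℕ)} :
    bs ∈ allLists cG.2.1 5 ↔
      ∃ b : ℕ → B, bs = (List.range 5).map fun j => wordCode (b j : Fin k → Fin n) := by
  rw [mem_allLists]
  constructor
  · rintro ⟨hl, hm⟩
    have : ∀ j : Fin 5, ∃ b : B, bs.getD j [] = wordCode (b : Fin k → Fin n) := fun j => by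
      have hj : (j : ℕ) < bs.length := by omega
      rw [List.getD_eq_getElem _ _ hj]
      exact (hG.2.1 _).1 (hm _ (List.getElem_mem hj))
    choose b hb using this
    refine ⟨fun j => b (Fin.ofNat 5 j), List.ext_getElem (by simp [hl]) fun j h1 h2 => ?_⟩
    have := hb (Fin.ofNat 5 j)
    simp only [Fin.val_ofNat, Nat.mod_eq_of_lt (hl ▸ h1), List.getD_eq_getElem _ _ h1] at this
    simp [this]
  · rintro ⟨b, rfl⟩
    refine ⟨by simp, fun w hw => ?_⟩
    obtain ⟨j, -, rfl⟩ := List.mem_map.1 hw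
    exact (hG.2.1 _).2 ⟨_, rfl⟩

lemma mem_stepCode (hG : cG.Represents g)
    (hrows : ∀ e, e ∈ rows ↔ ∃ t, e = (wordCode fun c => s c t, wordCode fun c => s c (t + 1)))
    (e : List ℕ × ℕ) : e ∈ stepCode k r cG.2.1 cG.2.2 rows ↔
      ∃ w out, IsStep g s w out ∧ e = (wordCode w, (out : ℕ)) := by
  have hP := blockLength_pos k r
  have code : ∀ (t : ℕ) (b : ℕ → B) (q : ℕ), q < blockLength k r →
      ((List.range (4 * blockLength k r)).map fun p =>
        blockCode k r (wordCode fun c => s c t)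
          (((List.range 5).map fun j => wordCode (b j : Fin k → Fin n)).getD
            ((p + q) / blockLength k r) []) ((p + q) % blockLength k r),
        blockCode k r (wordCode fun c => s c (t + 1)) (lookupD cG.2.2
          (((List.range 5).map fun j => wordCode (b j : Fin k → Fin n)).getD 1 [],
          ((List.range 5).map fun j => wordCode (b j : Fin k → Fin n)).getD 2 []) []) q) =
      (wordCode fun p : Fin (4 * blockLength k r) =>
        blocks (fun c => s c t) (fun j => (b j : Fin k → Fin n)) (p + q),
        ((block (fun c => s c (t + 1)) (g ![b 1, b 2] : Fin k → Fin n) q : Fin n) : ℕ)) :=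
    fun t b q hq => by
      refine Prod.ext (map_range_eq_wordCode fun p => ?_) ?_
      · have h5 : ((p : ℕ) + q) / blockLength k r < 5 :=
          Nat.div_lt_of_lt_mul (by have := p.2; linarith)
        rw [blocks, ← blockCode_eq _ _ (Nat.mod_lt _ hP)]
        congr 1
        simp [List.getD, h5]
      · have := lookup_table hG ![b 1, b 2]
        simp only [Matrix.cons_val_zero, Matrix.cons_val_one] at this
        dsimp only
        rw [← blockCode_eq _ _ hq, ← this]
        rfl
  simp only [stepCode, List.mem_flatMap, List.mem_map, List.mem_range, hrows, mem_letters hG]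
  constructor
  · rintro ⟨_, ⟨t, rfl⟩, _, ⟨b, rfl⟩, q, hq, rfl⟩
    exact ⟨_, _, ⟨t, b, q, hq, fun _ => rfl, rfl⟩, code t b q hq⟩
  · rintro ⟨w, _, ⟨t, b, q, hq, hw, rfl⟩, rfl⟩
    refine ⟨_, ⟨t, rfl⟩, _, ⟨b, rfl⟩, q, hq, ?_⟩
    rw [code t b q hq, ← funext hw]

end

/-! ### Rule tables and window graphs represent the intended automaton and SFT. -/

lemma exists_rule_of_steps {n d : ℕ} (hd : 0 < d) {steps : List (List ℕ × ℕ)}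
    (hsteps : ∀ e ∈ steps, e.2 < n) : ∃ f : (Fin d → Fin n) → Fin n,
      ∀ w, (f w : ℕ) = lookupD steps (wordCode w) (wordCode w).headI := by
  have : ∀ w : Fin d → Fin n, lookupD steps (wordCode w) (wordCode w).headI < n := fun w => by
    rcases lookupD_eq_or_mem steps (wordCode w) (wordCode w).headI with h | h
    · rw [h]
      obtain ⟨d, rfl⟩ := Nat.exists_eq_succ_of_ne_zero hd.ne'
      simp [wordCode, List.ofFn_succ]
    · exact hsteps _ h
  exact ⟨fun w => ⟨_, this w⟩, fun w => rfl⟩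

lemma ruleCode_represents {n d : ℕ} {m : ℤ} {steps : List (List ℕ × ℕ)}
    {f : (Fin d → Fin n) → Fin n}
    (hf : ∀ w, (f w : ℕ) = lookupD steps (wordCode w) (wordCode w).headI) :
    CACode.Represents (m, d, ruleCode n d steps) m f := by
  refine ⟨rfl, rfl, fun e => ?_⟩
  simp only [ruleCode, List.mem_map, mem_allLists, List.mem_range]
  constructor
  · rintro ⟨l, ⟨hl, hm⟩, rfl⟩
    obtain ⟨w, rfl⟩ := exists_wordCode hl hm
    exact ⟨w, by rw [hf]⟩
  · rintro ⟨w, rfl⟩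
    exact ⟨_, ⟨wordCode_length w, fun a => mem_wordCode⟩, by rw [hf]⟩

/-- The graph of the windows of length `d` presents the configurations with windows in `Q`. -/
lemma biLabels_windowGraph {n d : ℕ} (hd : 0 < d) {Q : (Fin d → Fin n) → Prop}
    {E : Finset (ℕ × Fin n × ℕ)}
    (hE : ∀ e, e ∈ E ↔ ∃ w, Q w ∧ e = (Encodable.encode ((wordCode w).take (d - 1)),
      w ⟨0, hd⟩, Encodable.encode (wordCode w).tail)) :
    biLabels E = {x | ∀ i : ℤ, Q fun j => x (i + (j : ℕ))} := by
  ext x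
  constructor
  · rintro ⟨v, hv⟩
    choose w hQ hw using fun i => (hE _).1 (hv i)
    simp only [Prod.mk.injEq] at hw
    -- The common vertex of consecutive edges says that the suffix of one window is the prefix of
    -- the next.
    have step : ∀ (i : ℤ) (j : ℕ) (hj : j + 1 < d),
        w i ⟨j + 1, hj⟩ = w (i + 1) ⟨j, by omega⟩ := fun i j hj => by
      have h1 := Encodable.encode_injective ((hw i).2.2.symm.trans (hw (i + 1)).1)
      have h2 := congrArg (fun l => l.getD j 0) h1
      have e1 : (wordCode (w i)).tail.getD j 0 = w i ⟨j + 1, hj⟩ := by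
        rw [← wordCode_getD (w i) hj 0]; simp [List.getD]
      have e2 : ((wordCode (w (i + 1))).take (d - 1)).getD j 0 = w (i + 1) ⟨j, by omega⟩ := by
        rw [← wordCode_getD (w (i + 1)) (by omega) 0]
        simp [List.getD, show j < d - 1 by omega]
      rw [e1, e2] at h2
      exact Fin.ext h2
    have hwx : ∀ (j : ℕ) (hj : j < d) (i : ℤ), w i ⟨j, hj⟩ = x (i + j) := fun j => by
      induction j with
      | zero => intro hj i; rw [← (hw i).2.1, Nat.cast_zero, add_zero]
      | succ j ih =>
        intro hj i
        rw [step, ih]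
        congr 1; push_cast; ring
    intro i
    have : (fun j : Fin d => x (i + (j : ℕ))) = w i := funext fun j => (hwx j j.2 i).symm
    rw [this]
    exact hQ i
  · intro hx
    refine ⟨fun i => Encodable.encode ((wordCode fun j : Fin d => x (i + (j : ℕ))).take (d - 1)),
      fun i => (hE _).2 ⟨_, hx i, ?_⟩⟩
    refine Prod.ext rfl (Prod.ext ?_ ?_)
    · simp
    · dsimp only
      congr 1
      refine List.ext_getElem (by simp [wordCode_length]) fun j h1 h2 => ?_
      simp only [wordCode, List.getElem_take, List.getElem_ofFn, List.getElem_tail]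
      congr 2; push_cast; ring

lemma windowGraph_represents {n d : ℕ} (hd : 0 < d) {Q : (Fin d → Fin n) → Prop}
    {steps : List (List ℕ × ℕ)} (hQ : ∀ w, Q w ↔ ∃ out, (wordCode w, out) ∈ steps)
    (hs : ∀ e ∈ steps, ∃ w : Fin d → Fin n, e.1 = wordCode w) :
    ∃ E : Finset (ℕ × Fin n × ℕ), GraphCode.Represents (windowGraph steps) E ∧
      biLabels E = {x | ∀ i : ℤ, Q fun j => x (i + (j : ℕ))} := by
  have hfin : {e : ℕ × Fin n × ℕ | ∃ w, Q w ∧ e = (Encodable.encode ((wordCode w).take (d - 1)),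
      w ⟨0, hd⟩, Encodable.encode (wordCode w).tail)}.Finite := by
    refine ((Set.toFinite {w | Q w}).image fun w => (Encodable.encode ((wordCode w).take (d - 1)),
      w ⟨0, hd⟩, Encodable.encode (wordCode w).tail)).subset ?_
    rintro _ ⟨w, hw, rfl⟩
    exact ⟨w, hw, rfl⟩
  have head : ∀ w : Fin d → Fin n, (wordCode w).headI = w ⟨0, hd⟩ := fun w => by
    obtain ⟨d, rfl⟩ := Nat.exists_eq_succ_of_ne_zero hd.ne'
    simp [wordCode, List.ofFn_succ]
  refine ⟨hfin.toFinset, fun e => ?_, biLabels_windowGraph hd fun e => by simp⟩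
  simp only [windowGraph, List.mem_map, Set.Finite.mem_toFinset]
  constructor
  · rintro ⟨⟨l, out⟩, he, rfl⟩
    obtain ⟨w, rfl⟩ : ∃ w : Fin d → Fin n, l = wordCode w := hs _ he
    exact ⟨_, _, _, ⟨w, (hQ w).2 ⟨out, he⟩, rfl⟩, by rw [head, wordCode_length]⟩
  · rintro ⟨p, a, q, ⟨w, hw, h⟩, rfl⟩
    obtain ⟨out, hout⟩ := (hQ w).1 hw
    refine ⟨_, hout, ?_⟩
    simp only [Prod.mk.injEq] at h
    rw [head, wordCode_length, h.1, h.2.1, h.2.2]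

/-- `out` represents a cellular automaton and a graph of a subshift of finite type on which its
trace is `S`. -/
def IsSolution (n : ℕ) (S : Set (ℕ → Fin n)) (out : CACode × GraphCode) : Prop :=
  ∃ (m : ℤ) (d : ℕ) (f : (Fin d → Fin n) → Fin n) (E' : Finset (ℕ × Fin n × ℕ)),
    out.1.Represents m f ∧ out.2.Represents E' ∧ PartiallyTraces m f (biLabels E') S

theorem output_isSolution {n k r : ℕ} {B : Set (Fin k → Fin n)} [Nonempty B]
    {g : (Fin 2 → B) → B} {cG : PolyCode} (hG : cG.Represents g) {s : Fin (r + 1) → ℕ → Fin n}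
    {rows : List RowCode}
    (hrows : ∀ e, e ∈ rows ↔ ∃ t, e = (wordCode fun c => s c t, wordCode fun c => s c (t + 1)))
    (hs : ∀ c, ∃ c', ∀ t, s c (t + 1) = s c' t) (H : (∀ t, ∃ c, s c t ≠ s 0 t) ∨ k = 0) :
    IsSolution n (Set.range s ∪ polytrace g) (output n k r cG.2.1 cG.2.2 rows) := by
  have hd : 0 < 4 * blockLength k r := by have := blockLength_pos k r; omega
  have hmem := mem_stepCode hG hrows
  obtain ⟨f, hf⟩ := exists_rule_of_steps (n := n) hd (steps := stepCode k r cG.2.1 cG.2.2 rows)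
    fun e he => by
      obtain ⟨w, out, -, rfl⟩ := (hmem e).1 he
      exact out.2
  obtain ⟨E', hE', hbi⟩ := windowGraph_represents hd (n := n)
    (steps := stepCode k r cG.2.1 cG.2.2 rows) (Q := fun w => ∃ out, IsStep g s w out)
    (fun w => by
      constructor
      · rintro ⟨out, h⟩
        exact ⟨_, (hmem _).2 ⟨w, out, h, rfl⟩⟩
      · rintro ⟨_, h⟩
        obtain ⟨w', out, h', he⟩ := (hmem _).1 h
        rw [wordCode_injective (congrArg Prod.fst he)]
        exact ⟨out, h'⟩)
    fun e he => by
      obtain ⟨w, out, -, rfl⟩ := (hmem e).1 he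
      exact ⟨w, rfl⟩
  refine ⟨_, _, f, E', ruleCode_represents hf, hE', ?_⟩
  rw [hbi]
  refine partiallyTraces_of_isStep hs H fun w out h => Fin.ext ?_
  rw [hf]
  refine lookupD_of_mem _ ((hmem _).2 ⟨w, out, h, rfl⟩) fun b' hb' => ?_
  obtain ⟨w', out', h', he⟩ := (hmem _).1 hb'
  simp only [Prod.mk.injEq] at he
  rw [← wordCode_injective he.1] at h'
  rw [he.2, h'.unique hs H h]

lemma output_nil_isSolution (n k r : ℕ) (letters table) :
    IsSolution n ∅ (output n k r letters table []) := by
  have hd : 0 < 4 * blockLength k r := by have := blockLength_pos k r; omega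
  obtain ⟨f, hf⟩ := exists_rule_of_steps (n := n) hd (steps := []) (by simp)
  refine ⟨_, _, f, ∅, ruleCode_represents hf, fun e => by simp [output, windowGraph, stepCode], ?_⟩
  have : biLabels (∅ : Finset (ℕ × Fin n × ℕ)) = ∅ := by
    ext x; simp [biLabels]
  rw [this]
  exact partiallyTraces_empty _ hd _

/-! ### Soundness and existence of certificates. -/

section certificates
variable {n : ℕ} {E : Finset (ℕ × Fin n × ℕ)} {cE : GraphCode}

lemma mem_rightLabels_code (hE : cE.Represents E) {y : ℕ → ℕ} :
    y ∈ rightLabels (List.toFinset cE) ↔ ∃ z ∈ rightLabels E, ∀ i, y i = z i := by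
  constructor
  · rintro ⟨v, hv⟩
    have : ∀ i, ∃ a : Fin n, (v i, a, v (i + 1)) ∈ E ∧ y i = a := fun i => by
      obtain ⟨p, a, q, h, he⟩ := (hE _).1 (List.mem_toFinset.1 (hv i))
      simp only [Prod.mk.injEq] at he
      exact ⟨a, by rwa [he.1, he.2.2], he.2.1⟩
    choose z hz hy using this
    exact ⟨z, ⟨v, hz⟩, hy⟩
  · rintro ⟨z, ⟨v, hv⟩, hy⟩
    exact ⟨v, fun i => List.mem_toFinset.2 ((hE _).2 ⟨_, _, _, hv i, by rw [hy]⟩)⟩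

lemma IsClosedWalk.isPath {c : List EdgeCode} (hc : IsClosedWalk cE c) (hl : 0 < c.length) :
    IsPath (List.toFinset cE) fun t => c.getD (t % c.length) (0, 0, 0) := fun t => by
  obtain ⟨h1, h2⟩ := hc _ (Nat.mod_lt t hl)
  rw [Nat.mod_add_mod] at h2
  exact ⟨List.mem_toFinset.2 h1, h2⟩

lemma IsClosedWalk.exists_periodic (hE : cE.Represents E) {c : List EdgeCode}
    (hc : IsClosedWalk cE c) (hl : 0 < c.length) : ∃ z ∈ rightLabels E,
      Function.Periodic z c.length ∧ ∀ t, (c.getD (t % c.length) (0, 0, 0)).2.1 = z t := by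
  obtain ⟨z, hz, h⟩ := (mem_rightLabels_code hE).1
    (mem_rightLabels.2 ⟨_, hc.isPath hl, fun _ => rfl⟩)
  exact ⟨z, hz, fun t => Fin.ext (by rw [← h, ← h, Nat.add_mod_right]), h⟩

theorem cycleOutput_isSolution {k : ℕ} {B : Set (Fin k → Fin n)} {g : (Fin 2 → B) → B}
    {cG : PolyCode} (hg : polytrace g = rightLabels E) (hG : cG.Represents g)
    (hE : cE.Represents E) {c : List EdgeCode × List EdgeCode} (hc : IsCycleCertificate cE c) :
    IsSolution n (rightLabels E) (cycleOutput (n, cG, cE) c) := by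
  obtain ⟨hl, hll, h1, h2, hne⟩ := hc
  obtain ⟨z, hz, hp, hzc⟩ := h1.exists_periodic hE hl
  obtain ⟨z', hz', hp', hzc'⟩ := h2.exists_periodic hE (hll ▸ hl)
  rw [← hll] at hp' hzc'
  have hr : 2 * c.1.length - 1 + 1 = 2 * c.1.length := by omega
  have : Nonempty B := by
    have m := hz
    rw [← hg] at m
    obtain ⟨_, _, ⟨x, -, rfl⟩, -⟩ := Set.mem_iUnion.1 m
    exact ⟨x 0⟩
  have hrow : ∀ t, cycleRow c t =
      wordCode fun i => cycleColumns (2 * c.1.length - 1) z z' i t := fun t => by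
    rw [cycleRow, ← hr]
    refine map_range_eq_wordCode fun i => ?_
    simp only [cycleColumns, hzc, hzc']
    split_ifs <;> rfl
  have hmod : ∀ t, cycleRow c (t % c.1.length) = cycleRow c t := fun t => by
    simp only [cycleRow, Nat.mod_add_mod]
  have hmod' : ∀ t, cycleRow c (t % c.1.length + 1) = cycleRow c (t + 1) := fun t => by
    rw [← hmod, Nat.mod_add_mod, hmod]
  have hne' : z 0 ≠ z' 0 := fun h => hne (by
    have e1 := hzc 0
    have e2 := hzc' 0
    rw [Nat.zero_mod] at e1 e2
    rw [e1, e2, h])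
  have := output_isSolution hG (s := cycleColumns (2 * c.1.length - 1) z z') (rows := cycleRows c)
    (fun e => by
      simp only [cycleRows, List.mem_map, List.mem_range, ← hrow]
      constructor
      · rintro ⟨t, -, rfl⟩; exact ⟨t, rfl⟩
      · rintro ⟨t, rfl⟩; exact ⟨t % c.1.length, Nat.mod_lt _ hl, by rw [hmod, hmod']⟩)
    (cycleColumns_shift hr hp hp') (Or.inl (cycleColumns_ne hr hl hp hp' hne'))
  rw [hg, Set.union_eq_right.2 (cycleColumns_mem hz hz')] at this
  rw [cycleOutput, hG.1]
  exact this

lemma exists_cycleCertificate (hE : cE.Represents E) (h : HasDistinctCycles E) :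
    ∃ c, IsCycleCertificate cE c := by
  obtain ⟨l, w, w', hl, hw, hw', hp, hp', hne⟩ := h
  let code : ℕ × Fin n × ℕ → EdgeCode := fun e => (e.1, (e.2.1 : ℕ), e.2.2)
  have closed : ∀ w : ℕ → ℕ × Fin n × ℕ, IsPath E w → Function.Periodic w l →
      IsClosedWalk cE ((List.range l).map fun t => code (w t)) := fun w hw hp i hi => by
    simp only [List.length_map, List.length_range] at hi ⊢
    have hm := Nat.mod_lt (i + 1) hl
    have hwm : w ((i + 1) % l) = w (i + 1) := hp.map_mod_nat _
    simp only [List.getD, List.getElem?_map, List.getElem?_range hi, List.getElem?_range hm, hwm,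
      Option.map_some, Option.getD_some]
    exact ⟨(hE _).2 ⟨_, _, _, (hw i).1, rfl⟩, (hw i).2⟩
  refine ⟨((List.range l).map fun t => code (w t), (List.range l).map fun t => code (w' t)),
    by simpa using hl, by simp, closed w hw hp, closed w' hw' hp', ?_⟩
  simp only [List.getD, List.getElem?_map, List.getElem?_range hl, Option.map_some,
    Option.getD_some]
  exact fun h => hne (Fin.ext h)

lemma mem_prefixCode (cE : List EdgeCode) (N : ℕ) (l : List ℕ) :
    l ∈ prefixCode cE N ↔ ∃ y ∈ rightLabels cE.toFinset, l = (List.range N).map y := by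
  simp only [prefixCode, List.mem_map, List.mem_filter, mem_allLists, decide_eq_true_eq]
  constructor
  · rintro ⟨w, ⟨⟨hl, hm⟩, hw⟩, rfl⟩
    set e : ℕ → EdgeCode := fun t => w.getD t (0, 0, 0) with he
    have heq : ∀ t (ht : t < w.length), e t = w[t] := fun t ht => List.getD_eq_getElem _ _ ht
    obtain ⟨i, j, hij, hj, h⟩ : ∃ i j, i < j ∧ j < cE.length + 1 ∧ e (N + i) = e (N + j) := by
      obtain ⟨i, hi, j, hj, hne, h⟩ := Finset.exists_ne_map_eq_of_card_lt_of_maps_to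
        (s := Finset.range (cE.length + 1)) (t := cE.toFinset) (f := fun i => e (N + i))
        (by simpa using Nat.lt_succ_of_le (List.toFinset_card_le cE)) (fun i hi => by
          have hi := Finset.mem_range.1 (Finset.mem_coe.1 hi)
          dsimp only
          rw [heq _ (by omega)]
          simpa using hm _ (List.getElem_mem _))
      rw [Finset.mem_range] at hi hj
      rcases lt_or_gt_of_ne hne with hlt | hlt
      exacts [⟨i, j, hlt, hj, h⟩, ⟨j, i, hlt, hi, h.symm⟩]
    obtain ⟨w', hw', h1, -⟩ := exists_lasso (E := cE.toFinset) (e := e) (i := N + i) (j := N + j)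
      (by omega) h fun t ht => by
        refine ⟨?_, hw t (by omega)⟩
        rw [heq t (by omega)]
        simpa using hm _ (List.getElem_mem _)
    refine ⟨_, mem_rightLabels.2 ⟨w', hw', fun _ => rfl⟩,
      List.ext_getElem (by simp; omega) fun t h2 h3 => ?_⟩
    have ht : t < N := by simpa using h3
    simp [h1 t (by omega), heq t (by omega)]
  · rintro ⟨y, hy, rfl⟩
    obtain ⟨w, hw, hwy⟩ := mem_rightLabels.1 hy
    refine ⟨(List.range (N + cE.length + 1)).map w, ⟨⟨by simp, fun e he => ?_⟩, fun i hi => ?_⟩,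
      List.ext_getElem (by simp; omega) fun t h2 h3 => by simp [hwy]⟩
    · obtain ⟨t, -, rfl⟩ := List.mem_map.1 he
      exact List.mem_toFinset.1 (hw t).1
    · simp only [List.length_map, List.length_range] at hi
      simp only [List.getD, List.getElem?_map, List.getElem?_range
        (show i < N + cE.length + 1 by omega), List.getElem?_range
        (show i + 1 < N + cE.length + 1 by omega), Option.map_some, Option.getD_some]
      exact (hw i).2

lemma mem_prefixCode_iff (hE : cE.Represents E) (N : ℕ) (l : List ℕ) :
    l ∈ prefixCode cE N ↔
      ∃ z ∈ rightLabels E, l = (List.range N).map fun i => (z i : ℕ) := by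
  rw [mem_prefixCode]
  constructor
  · rintro ⟨y, hy, rfl⟩
    obtain ⟨z, hz, h⟩ := (mem_rightLabels_code hE).1 hy
    exact ⟨z, hz, by simp only [← h]⟩
  · rintro ⟨z, hz, rfl⟩
    exact ⟨_, (mem_rightLabels_code hE).2 ⟨z, hz, fun _ => rfl⟩, rfl⟩

lemma map_range_getD (z : ℕ → ℕ) {N t : ℕ} (ht : t < N) (a : ℕ) :
    ((List.range N).map z).getD t a = z t := by
  simp [List.getD, List.getElem?_range ht]

lemma exists_nilpotencyCertificate (hE : cE.Represents E)
    (h : rightLabels E = ∅ ∨ ∃ N a, ∀ z ∈ rightLabels E, ∀ t, N ≤ t → z t = a) :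
    ∃ c, IsNilpotencyCertificate cE c := by
  rcases h with h | ⟨N, a, h⟩
  · refine ⟨(0, 0), fun w hw => ?_⟩
    obtain ⟨z, hz, -⟩ := (mem_prefixCode_iff hE _ _).1 hw
    rw [h] at hz
    exact hz.elim
  · refine ⟨(N, a), fun w hw => ?_⟩
    obtain ⟨z, hz, rfl⟩ := (mem_prefixCode_iff hE _ _).1 hw
    rw [map_range_getD _ (Nat.lt_succ_self N), h z hz N le_rfl]

theorem nilpotentOutput_isSolution {cG : PolyCode} (hE : cE.Represents E) {c : ℕ × ℕ}
    (hc : IsNilpotencyCertificate cE c) :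
    IsSolution n (rightLabels E) (nilpotentOutput (n, cG, cE) c) := by
  obtain ⟨N, a⟩ := c
  rcases Set.eq_empty_or_nonempty (rightLabels E) with h | ⟨z₀, hz₀⟩
  · have hnil : prefixCode cE N = [] := List.eq_nil_iff_forall_not_mem.2 fun l hl => by
      obtain ⟨z, hz, -⟩ := (mem_prefixCode_iff hE _ _).1 hl
      rw [h] at hz
      exact hz.elim
    rw [h, nilpotentOutput, nilpotentRows, hnil]
    exact output_nil_isSolution _ _ _ _ _
  have hNa : ∀ z ∈ rightLabels E, ∀ t, N ≤ t → (z t : ℕ) = a := fun z hz t ht => by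
    have := hc _ ((mem_prefixCode_iff hE _ _).2 ⟨_, shift_mem_rightLabels hz (t - N), rfl⟩)
    rw [map_range_getD _ (Nat.lt_succ_self N)] at this
    rwa [Nat.add_sub_cancel' ht] at this
  obtain ⟨a, rfl⟩ : ∃ a' : Fin n, (a' : ℕ) = a := ⟨z₀ N, hNa z₀ hz₀ N le_rfl⟩
  have : ∀ i : Fin (prefixCode cE N).length, ∃ z ∈ rightLabels E,
      (prefixCode cE N).get i = (List.range N).map fun i => (z i : ℕ) := fun i =>
    (mem_prefixCode_iff hE _ _).1 (List.get_mem _ _)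
  choose y hyE hy using this
  let s : Fin ((prefixCode cE N).length + 1) → ℕ → Fin n := Fin.cons (fun _ => a) y
  have hrange : Set.range s = rightLabels E := by
    apply Set.Subset.antisymm
    · rintro _ ⟨c, rfl⟩
      refine Fin.cases ?_ (fun i => ?_) c
      · have := shift_mem_rightLabels hz₀ N
        convert this using 1
        funext t
        exact Fin.ext (hNa z₀ hz₀ _ (by omega)).symm
      · exact hyE i
    · intro z hz
      obtain ⟨i, hi⟩ := List.mem_iff_get.1 ((mem_prefixCode_iff hE N _).2 ⟨z, hz, rfl⟩)
      refine ⟨i.succ, funext fun t => Fin.ext ?_⟩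
      rw [hy] at hi
      change (y i t : ℕ) = z t
      by_cases ht : t < N
      · rw [← map_range_getD (fun i => (z i : ℕ)) ht 0, ← hi, map_range_getD _ ht]
      · rw [hNa z hz t (by omega), hNa _ (hyE i) t (by omega)]
  have hmem : ∀ c, s c ∈ rightLabels E := fun c => hrange ▸ Set.mem_range_self c
  have hrow : ∀ t, nilpotentRow cE (N, a) t = wordCode fun c => s c t := fun t => by
    rw [nilpotentRow, wordCode, List.ofFn_succ]
    congr 1
    refine List.ext_getElem (by simp) fun i h1 h2 => ?_
    have hi : i < (prefixCode cE N).length := by simpa using h1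
    have h3 := hy ⟨i, hi⟩
    simp only [List.get_eq_getElem] at h3
    simp only [List.getElem_map, List.getElem_ofFn, h3]
    change _ = (y ⟨i, hi⟩ t : ℕ)
    by_cases ht : t < N
    · rw [map_range_getD _ ht]
    · rw [hNa _ (hyE _) t (by omega), List.getD_eq_default _ _ (by simpa using not_lt.1 ht)]
  have hconst : ∀ t, N ≤ t → nilpotentRow cE (N, a) t = nilpotentRow cE (N, a) N := fun t ht => by
    rw [hrow, hrow]
    congr 1; funext c
    exact Fin.ext ((hNa _ (hmem c) t ht).trans (hNa _ (hmem c) N le_rfl).symm)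
  have hne : prefixCode cE N ≠ [] := List.ne_nil_of_mem ((mem_prefixCode_iff hE N _).2 ⟨z₀, hz₀, rfl⟩)
  let g₀ : (Fin 2 → (Set.univ : Set (Fin 0 → Fin n))) → (Set.univ : Set (Fin 0 → Fin n)) :=
    fun b => b 0
  have hG : PolyCode.Represents (0, [[]], [(([], []), [])]) g₀ := by
    refine ⟨rfl, fun w => ?_, fun e => ?_⟩
    · simp only [List.mem_singleton]
      exact ⟨fun h => ⟨⟨Fin.elim0, trivial⟩, by simp [h, wordCode]⟩,
        fun ⟨b, hb⟩ => by simp [hb, wordCode]⟩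
    · simp only [List.mem_singleton]
      exact ⟨fun h => ⟨fun _ => ⟨Fin.elim0, trivial⟩, by simp [h, wordCode]⟩,
        fun ⟨b, hb⟩ => by simp [hb, wordCode]⟩
  have := output_isSolution hG (s := s) (rows := nilpotentRows cE (N, a)) (fun e => by
      simp only [nilpotentRows, List.mem_flatMap, List.mem_map, List.mem_range, ← hrow]
      constructor
      · rintro ⟨_, _, t, -, rfl⟩
        exact ⟨t, rfl⟩
      · rintro ⟨t, rfl⟩
        obtain ⟨l, hl⟩ := List.exists_mem_of_ne_nil _ hne
        by_cases ht : t < N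
        · exact ⟨l, hl, t, by omega, rfl⟩
        · exact ⟨l, hl, N, by omega, by
            rw [hconst t (by omega), hconst (t + 1) (by omega), hconst (N + 1) (by omega)]⟩)
    (columns_shift_of_range_eq hrange) (Or.inr rfl)
  rw [polytrace_zero, Set.union_empty, hrange] at this
  exact this

theorem attempt_isSolution {k : ℕ} {B : Set (Fin k → Fin n)} {g : (Fin 2 → B) → B}
    {cG : PolyCode} (hg : polytrace g = rightLabels E) (hG : cG.Represents g)
    (hE : cE.Represents E) {i : ℕ} {out : CACode × GraphCode}
    (h : attempt (n, cG, cE) i = some out) : IsSolution n (rightLabels E) out := by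
  rw [attempt] at h
  rcases (Option.orElse_eq_some _ _ _).1 h with h | ⟨-, h⟩ <;>
  · obtain ⟨c, -, h⟩ := Option.bind_eq_some_iff.1 h
    split_ifs at h with hc
    obtain rfl := Option.some_injective _ h
    first
    | exact cycleOutput_isSolution hg hG hE hc
    | exact nilpotentOutput_isSolution hE hc

theorem exists_attempt {k : ℕ} {B : Set (Fin k → Fin n)} {g : (Fin 2 → B) → B}
    {cG : PolyCode} (hg : polytrace g = rightLabels E)
    (hE : cE.Represents E) : ∃ i out, attempt (n, cG, cE) i = some out := by
  rcases hasDistinctCycles_or_nilpotent g hg with h | h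
  · obtain ⟨c, hc⟩ := exists_cycleCertificate hE h
    refine ⟨Encodable.encode c, cycleOutput (n, cG, cE) c, ?_⟩
    rw [attempt, Encodable.encodek, Option.bind_some, if_pos hc]
    rfl
  · obtain ⟨c, hc⟩ := exists_nilpotencyCertificate hE h
    refine ⟨Encodable.encode c, ?_⟩
    rw [attempt, Encodable.encodek, Option.bind_some, if_pos hc]
    -- The same index may also decode to a valid cycle certificate, which takes precedence; the
    -- attempt succeeds in either case.
    generalize (Encodable.decode (α := List EdgeCode × List EdgeCode) (Encodable.encode c)).bind _ = o
    cases o with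
    | none => exact ⟨_, rfl⟩
    | some out => exact ⟨out, rfl⟩

end certificates

/-! ### Computability -/

section computability
open Primrec
variable {α : Type*} [Primcodable α]

lemma primrec_markerIndex {k r p : α → ℕ} (hk : Primrec k) (hr : Primrec r) (hp : Primrec p) :
    Primrec fun a => markerIndex (k a) (r a) (p a) := by
  have hr1 : Primrec fun a => r a + 1 := nat_add.comp hr (const 1)
  have hs : Primrec fun a => p a / (r a + 1) - (r a + k a + 2) :=
    nat_sub.comp (nat_div.comp hp hr1) (nat_add.comp (nat_add.comp hr hk) (const 2))
  exact Primrec.ite (nat_lt.comp (nat_mod.comp hp hr1) hs) hs (const 0)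

lemma primrec_markerLength {k r : α → ℕ} (hk : Primrec k) (hr : Primrec r) :
    Primrec fun a => markerLength (k a) (r a) := by
  have hr1 : Primrec fun a => r a + 1 := nat_add.comp hr (const 1)
  exact nat_mul.comp (nat_add.comp (nat_add.comp (nat_mul.comp (const 2) hr1) hk) (const 1)) hr1

lemma primrec_blockLength {k r : α → ℕ} (hk : Primrec k) (hr : Primrec r) :
    Primrec fun a => blockLength (k a) (r a) :=
  nat_add.comp (primrec_markerLength hk hr) hk

lemma primrec_blockCode {k r p : α → ℕ} {ρ d : α → List ℕ} (hk : Primrec k) (hr : Primrec r)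
    (hρ : Primrec ρ) (hd : Primrec d) (hp : Primrec p) :
    Primrec fun a => blockCode (k a) (r a) (ρ a) (d a) (p a) :=
  Primrec.ite (nat_lt.comp hp (primrec_markerLength hk hr))
    ((list_getD 0).comp hρ (primrec_markerIndex hk hr hp))
    ((list_getD 0).comp hd (nat_sub.comp hp (primrec_markerLength hk hr)))

lemma primrec_lookupD {β γ : Type*} [Primcodable β] [Primcodable γ] [DecidableEq β]
    {l : α → List (β × γ)} {x : α → β} {d : α → γ} (hl : Primrec l) (hx : Primrec x)
    (hd : Primrec d) : Primrec fun a => lookupD (l a) (x a) (d a) :=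
  option_getD.comp (listLookup.comp hx hl) hd

lemma primrec_allLists {β : Type*} [Primcodable β] {l : α → List β} {m : α → ℕ} (hl : Primrec l)
    (hm : Primrec m) : Primrec fun a => allLists (l a) (m a) := by
  have hstep : Primrec₂ fun (a : α) (p : ℕ × List (List β)) =>
      (l a).flatMap fun x => p.2.map fun w => x :: w :=
    list_flatMap (hl.comp fst) (list_map (snd.comp (snd.comp fst))
      (list_cons.comp (snd.comp fst) snd).to₂).to₂
  refine (nat_rec' hm (const [[]]) hstep).of_eq fun a => ?_
  induction m a with
  | zero => rfl
  | succ m ih => simp only [ih, allLists]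

lemma primrec_stepCode {k r : α → ℕ} {letters : α → List (List ℕ)}
    {table : α → List ((List ℕ × List ℕ) × List ℕ)} {rows : α → List RowCode} (hk : Primrec k)
    (hr : Primrec r) (hl : Primrec letters) (ht : Primrec table) (hρ : Primrec rows) :
    Primrec fun a => stepCode (k a) (r a) (letters a) (table a) (rows a) := by
  have hP := primrec_blockLength hk hr
  have hword : Primrec₂ fun (x : ((α × RowCode) × List (List ℕ)) × ℕ) (p : ℕ) =>
      blockCode (k x.1.1.1) (r x.1.1.1) x.1.1.2.1
        (x.1.2.getD ((p + x.2) / blockLength (k x.1.1.1) (r x.1.1.1)) [])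
        ((p + x.2) % blockLength (k x.1.1.1) (r x.1.1.1)) := by
    have hα : Primrec fun x : (((α × RowCode) × List (List ℕ)) × ℕ) × ℕ => x.1.1.1.1 :=
      fst.comp (fst.comp (fst.comp fst))
    have hy : Primrec fun x : (((α × RowCode) × List (List ℕ)) × ℕ) × ℕ => x.2 + x.1.2 :=
      nat_add.comp snd (snd.comp fst)
    exact primrec_blockCode (hk.comp hα) (hr.comp hα)
      (fst.comp (snd.comp (fst.comp (fst.comp fst))))
      ((list_getD []).comp (snd.comp (fst.comp fst)) (nat_div.comp hy (hP.comp hα)))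
      (nat_mod.comp hy (hP.comp hα))
  have hα : Primrec fun x : ((α × RowCode) × List (List ℕ)) × ℕ => x.1.1.1 :=
    fst.comp (fst.comp fst)
  have hbs : Primrec fun x : ((α × RowCode) × List (List ℕ)) × ℕ => x.1.2 := snd.comp fst
  have hout : Primrec fun x : ((α × RowCode) × List (List ℕ)) × ℕ =>
      blockCode (k x.1.1.1) (r x.1.1.1) x.1.1.2.2
        (lookupD (table x.1.1.1) (x.1.2.getD 1 [], x.1.2.getD 2 []) []) x.2 :=
    primrec_blockCode (hk.comp hα) (hr.comp hα) (snd.comp (snd.comp (fst.comp fst)))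
      (primrec_lookupD (ht.comp hα) (Primrec.pair ((list_getD []).comp hbs (const 1))
        ((list_getD []).comp hbs (const 2))) (const [])) snd
  have hpair : Primrec₂ fun (x : (α × RowCode) × List (List ℕ)) (q : ℕ) =>
      ((List.range (4 * blockLength (k x.1.1) (r x.1.1))).map fun p =>
          blockCode (k x.1.1) (r x.1.1) x.1.2.1
            (x.2.getD ((p + q) / blockLength (k x.1.1) (r x.1.1)) [])
            ((p + q) % blockLength (k x.1.1) (r x.1.1)),
        blockCode (k x.1.1) (r x.1.1) x.1.2.2
          (lookupD (table x.1.1) (x.2.getD 1 [], x.2.getD 2 []) []) q) :=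
    Primrec.pair (list_map (list_range.comp (nat_mul.comp (const 4) (hP.comp hα))) hword) hout
  have hinner : Primrec fun x : (α × RowCode) × List (List ℕ) =>
      (List.range (blockLength (k x.1.1) (r x.1.1))).map fun q =>
        ((List.range (4 * blockLength (k x.1.1) (r x.1.1))).map fun p =>
            blockCode (k x.1.1) (r x.1.1) x.1.2.1
              (x.2.getD ((p + q) / blockLength (k x.1.1) (r x.1.1)) [])
              ((p + q) % blockLength (k x.1.1) (r x.1.1)),
          blockCode (k x.1.1) (r x.1.1) x.1.2.2
            (lookupD (table x.1.1) (x.2.getD 1 [], x.2.getD 2 []) []) q) :=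
    list_map (list_range.comp (hP.comp (fst.comp fst))) hpair
  have hletters : Primrec fun x : α × RowCode => allLists (letters x.1) 5 :=
    primrec_allLists (hl.comp fst) (const 5)
  exact list_flatMap hρ (list_flatMap hletters hinner.to₂).to₂

lemma primrec_ruleCode {n d : α → ℕ} {steps : α → List (List ℕ × ℕ)} (hn : Primrec n)
    (hd : Primrec d) (hs : Primrec steps) : Primrec fun a => ruleCode (n a) (d a) (steps a) :=
  list_map (primrec_allLists (list_range.comp hn) hd)
    (Primrec.pair snd (primrec_lookupD (hs.comp fst) snd (list_headI.comp snd))).to₂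

lemma primrec_windowGraph {steps : α → List (List ℕ × ℕ)} (hs : Primrec steps) :
    Primrec fun a => windowGraph (steps a) := by
  have he : Primrec fun x : α × (List ℕ × ℕ) => x.2.1 := fst.comp snd
  exact list_map hs (Primrec.pair (Primrec.encode.comp (list_take.comp
    (nat_sub.comp (list_length.comp he) (const 1)) he)) (Primrec.pair (list_headI.comp he)
      (Primrec.encode.comp (list_tail.comp he)))).to₂

/-- The encoding of the integers sends a natural number `n` to `2 * n`. -/
lemma primrec_natCast_int : Primrec fun n : ℕ => (n : ℤ) :=
  Primrec.encode_iff.1 (nat_double.of_eq fun _ => rfl)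

lemma primrec_output {n k r : α → ℕ} {letters : α → List (List ℕ)}
    {table : α → List ((List ℕ × List ℕ) × List ℕ)} {rows : α → List RowCode} (hn : Primrec n)
    (hk : Primrec k) (hr : Primrec r) (hl : Primrec letters) (ht : Primrec table)
    (hρ : Primrec rows) :
    Primrec fun a => output (n a) (k a) (r a) (letters a) (table a) (rows a) := by
  have hP := primrec_blockLength hk hr
  have hd : Primrec fun a => 4 * blockLength (k a) (r a) := nat_mul.comp (const 4) hP
  have hs := primrec_stepCode hk hr hl ht hρ
  exact Primrec.pair (Primrec.pair (primrec_natCast_int.comp hP)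
    (Primrec.pair hd (primrec_ruleCode hn hd hs))) (primrec_windowGraph hs)

lemma primrecRel_mem_list : PrimrecRel fun (L : List α) (a : α) => a ∈ L :=
  (PrimrecRel.exists_mem_list (R := fun a b : α => a = b) Primrec.eq).of_eq fun L a => by simp

lemma primrecRel_forall_lt {R : ℕ → α → Prop} (hR : PrimrecRel R) :
    PrimrecRel fun n a => ∀ i < n, R i a :=
  (hR.forall_mem_list.comp (list_range.comp fst) snd).of_eq (by simp)

lemma primrecRel_isClosedWalk : PrimrecRel IsClosedWalk := by
  let X := List EdgeCode × List EdgeCode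
  have hc : Primrec fun x : ℕ × X => x.2.2 := snd.comp snd
  have hi : Primrec fun x : ℕ × X => x.2.2.getD x.1 (0, 0, 0) := (list_getD _).comp hc fst
  have hi' : Primrec fun x : ℕ × X => x.2.2.getD ((x.1 + 1) % x.2.2.length) (0, 0, 0) :=
    (list_getD _).comp hc (nat_mod.comp (Primrec.succ.comp fst) (list_length.comp hc))
  have h1 : PrimrecPred fun x : ℕ × X => x.2.2.getD x.1 (0, 0, 0) ∈ x.2.1 :=
    primrecRel_mem_list.comp (fst.comp snd) hi
  have h2 : PrimrecPred fun x : ℕ × X => (x.2.2.getD x.1 (0, 0, 0)).2.2 =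
      (x.2.2.getD ((x.1 + 1) % x.2.2.length) (0, 0, 0)).1 :=
    Primrec.eq.comp (snd.comp (snd.comp hi)) (fst.comp hi')
  have h3 : PrimrecRel fun (i : ℕ) (x : X) => x.2.getD i (0, 0, 0) ∈ x.1 ∧
      (x.2.getD i (0, 0, 0)).2.2 = (x.2.getD ((i + 1) % x.2.length) (0, 0, 0)).1 := h1.and h2
  exact (primrecRel_forall_lt h3).comp (list_length.comp snd) Primrec.id

lemma primrecRel_isCycleCertificate : PrimrecRel IsCycleCertificate := by
  let X := List EdgeCode × List EdgeCode × List EdgeCode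
  have hE : Primrec fun x : X => x.1 := fst
  have h1 : Primrec fun x : X => x.2.1 := fst.comp snd
  have h2 : Primrec fun x : X => x.2.2 := snd.comp snd
  have hne : PrimrecPred fun x : X =>
      (x.2.1.getD 0 (0, 0, 0)).2.1 ≠ (x.2.2.getD 0 (0, 0, 0)).2.1 :=
    (Primrec.eq.comp (fst.comp (snd.comp ((list_getD _).comp h1 (const 0))))
      (fst.comp (snd.comp ((list_getD _).comp h2 (const 0))))).not
  exact (nat_lt.comp (const 0) (list_length.comp h1)).and
    ((Primrec.eq.comp (list_length.comp h1) (list_length.comp h2)).and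
      ((primrecRel_isClosedWalk.comp hE h1).and ((primrecRel_isClosedWalk.comp hE h2).and hne)))

lemma primrec_cycleRow {c : α → List EdgeCode × List EdgeCode} {t : α → ℕ} (hc : Primrec c)
    (ht : Primrec t) : Primrec fun a => cycleRow (c a) (t a) := by
  have hl : Primrec fun a => (c a).1.length := list_length.comp (fst.comp hc)
  have hi : Primrec fun x : α × ℕ => (t x.1 + x.2 / 2) % (c x.1).1.length :=
    nat_mod.comp (nat_add.comp (ht.comp fst) (nat_div.comp snd (const 2))) (hl.comp fst)
  exact list_map (list_range.comp (nat_mul.comp (const 2) hl))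
    (Primrec.ite (Primrec.eq.comp (nat_mod.comp snd (const 2)) (const 0))
      (fst.comp (snd.comp ((list_getD _).comp (fst.comp (hc.comp fst)) hi)))
      (fst.comp (snd.comp ((list_getD _).comp (snd.comp (hc.comp fst)) hi)))).to₂

lemma primrec_cycleRows : Primrec cycleRows :=
  list_map (list_range.comp (list_length.comp fst))
    (Primrec.pair (primrec_cycleRow fst snd) (primrec_cycleRow fst (Primrec.succ.comp snd))).to₂

lemma primrec_prefixCode {cE : α → List EdgeCode} {N : α → ℕ} (hE : Primrec cE) (hN : Primrec N) :
    Primrec fun a => prefixCode (cE a) (N a) := by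
  have hrel : PrimrecRel fun (i : ℕ) (w : List EdgeCode) =>
      (w.getD i (0, 0, 0)).2.2 = (w.getD (i + 1) (0, 0, 0)).1 :=
    Primrec.eq.comp (snd.comp (snd.comp ((list_getD _).comp snd fst)))
      (fst.comp ((list_getD _).comp snd (Primrec.succ.comp fst)))
  have hpred : PrimrecPred fun w : List EdgeCode => ∀ i < w.length - 1,
      (w.getD i (0, 0, 0)).2.2 = (w.getD (i + 1) (0, 0, 0)).1 :=
    (primrecRel_forall_lt hrel).comp (nat_sub.comp list_length (const 1)) Primrec.id
  exact list_map ((listFilter hpred).comp (primrec_allLists hE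
    (Primrec.succ.comp (nat_add.comp hN (list_length.comp hE)))))
    (list_map (list_take.comp (hN.comp fst) snd) (fst.comp (snd.comp snd)).to₂).to₂

lemma primrecRel_isNilpotencyCertificate : PrimrecRel IsNilpotencyCertificate := by
  have hrel : PrimrecRel fun (w : List ℕ) (c : ℕ × ℕ) => w.getD c.1 0 = c.2 :=
    Primrec.eq.comp ((list_getD 0).comp fst (fst.comp snd)) (snd.comp snd)
  exact hrel.forall_mem_list.comp
    (primrec_prefixCode fst (Primrec.succ.comp (fst.comp snd))) snd

lemma primrec_nilpotentRow {cE : α → List EdgeCode} {c : α → ℕ × ℕ} {t : α → ℕ} (hE : Primrec cE)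
    (hc : Primrec c) (ht : Primrec t) : Primrec fun a => nilpotentRow (cE a) (c a) (t a) :=
  list_cons.comp (snd.comp hc) (list_map (primrec_prefixCode hE (fst.comp hc))
    (option_getD.comp (list_getElem?.comp snd (ht.comp fst)) (snd.comp (hc.comp fst))).to₂)

lemma primrec_nilpotentRows {cE : α → List EdgeCode} {c : α → ℕ × ℕ} (hE : Primrec cE)
    (hc : Primrec c) : Primrec fun a => nilpotentRows (cE a) (c a) := by
  have hE' : Primrec fun x : (α × List ℕ) × ℕ => cE x.1.1 := hE.comp (fst.comp fst)
  have hc' : Primrec fun x : (α × List ℕ) × ℕ => c x.1.1 := hc.comp (fst.comp fst)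
  exact list_flatMap (primrec_prefixCode hE (fst.comp hc))
    (list_map (list_range.comp (Primrec.succ.comp (fst.comp (hc.comp fst))))
      (Primrec.pair (primrec_nilpotentRow hE' hc' snd)
        (primrec_nilpotentRow hE' hc' (Primrec.succ.comp snd))).to₂).to₂

lemma primrec_cycleOutput : Primrec₂ cycleOutput := by
  have hG : Primrec fun x : (ℕ × PolyCode × GraphCode) × (List EdgeCode × List EdgeCode) =>
      x.1.2.1 := fst.comp (snd.comp fst)
  exact primrec_output (fst.comp fst) (fst.comp hG) (nat_sub.comp (nat_mul.comp (const 2)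
    (list_length.comp (fst.comp snd))) (const 1)) (fst.comp (snd.comp hG)) (snd.comp (snd.comp hG))
    (primrec_cycleRows.comp snd)

lemma primrec_nilpotentOutput : Primrec₂ nilpotentOutput := by
  have hE : Primrec fun x : (ℕ × PolyCode × GraphCode) × (ℕ × ℕ) => x.1.2.2 :=
    snd.comp (snd.comp fst)
  exact primrec_output (fst.comp fst) (const 0)
    (list_length.comp (primrec_prefixCode hE (fst.comp snd))) (const [[]]) (const _)
    (primrec_nilpotentRows hE snd)

lemma primrec_attempt : Primrec₂ attempt := by
  classical
  have hE : ∀ {β : Type} [Primcodable β],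
      Primrec fun x : ((ℕ × PolyCode × GraphCode) × ℕ) × β => x.1.1.2.2 :=
    snd.comp (snd.comp (fst.comp fst))
  refine option_orElse.comp (option_bind (Primrec.decode.comp snd) (Primrec.ite
    (primrecRel_isCycleCertificate.comp hE snd)
    (option_some.comp (primrec_cycleOutput.comp (fst.comp fst) snd)) (const none)).to₂)
    (option_bind (Primrec.decode.comp snd) (Primrec.ite
    (primrecRel_isNilpotencyCertificate.comp hE snd)
    (option_some.comp (primrec_nilpotentOutput.comp (fst.comp fst) snd)) (const none)).to₂)

end computability

end PartialTrace

theorem propositionp :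
    -- every polytraceable sofic subshift over a finite alphabet is partially traceable
    (∀ (A : Type*) [Finite A] (S : Set (ℕ → A)),
      IsSofic S → IsPolytraceable S → IsPartiallyTraceable S) ∧
    -- one algorithm, whose inputs are the alphabet, a polytracing cellular automaton and a graph of
    -- the sofic subshift, computes a tracing partial cellular automaton and a graph of its domain
    ∃ Φ : ℕ × PolyCode × GraphCode →. CACode × GraphCode, Partrec Φ ∧
      ∀ (n : ℕ) (S : Set (ℕ → Fin n))
        (k : ℕ) (B : Set (Fin k → Fin n)) (g : (Fin 2 → B) → B) (cG : PolyCode)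
        (E : Finset (ℕ × Fin n × ℕ)) (cE : GraphCode),
        polytrace g = S → cG.Represents g →
        rightLabels E = S → cE.Represents E →
        ∃ out ∈ Φ (n, cG, cE),
          ∃ (m : ℤ) (d : ℕ) (f : (Fin d → Fin n) → Fin n) (E' : Finset (ℕ × Fin n × ℕ)),
            out.1.Represents m f ∧ out.2.Represents E' ∧
            PartiallyTraces m f (biLabels E') S := by
  -- The algorithm is an unbounded search over primitive recursive attempts: `exists_attempt` makes
  -- it halt on valid inputs and `attempt_isSolution` validates whatever it finds first.
  refine ⟨fun A _ S => isPartiallyTraceable_of_isSofic_of_isPolytraceable,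
    fun a => Nat.rfindOpt (attempt a), Partrec.rfindOpt primrec_attempt.to_comp, ?_⟩
  rintro n _ k B g cG E cE hg hG rfl hE
  obtain ⟨i, out, h⟩ := exists_attempt hg hE
  have hdom := Nat.rfindOpt_dom.2 ⟨i, out, h⟩
  obtain ⟨j, hj⟩ := Nat.rfindOpt_spec ⟨hdom, rfl⟩
  exact ⟨_, ⟨hdom, rfl⟩, attempt_isSolution hg hG hE hj⟩
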